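/- Let $p$ be a prime, let $e,m,k\ge 1$ be integers, and let $q=p^e$. For $a\in\mathbb{N}$ let $S_p(a)$ be the sum of the base-$p$ digits of $a$, and let $\nu_p$ be the $p$-adic valuation, with $\nu_p(0)=\infty$. For $f\in\mathbb{F}_{q^m}[x_1,\ldots,x_k]$ let $\mathrm{Deg}(f)$ be the set of degrees of the nonzero homogeneous parts of $f$, and let $N(f=y^q-y)$ be the number of $(x_1,\ldots,x_k,y)\in\mathbb{F}_{q^m}^{k+1}$ with $f(x_1,\ldots,x_k)=y^q-y$. Let $D\subseteq\{0,1,\ldots,k(q^m-1)\}$ be nonempty with $D\ne\{0\}$, and put $$\mathcal{T}_D=\{t=(t_1,\ldots,t_k)\in\{0,\ldots,q^m-1\}^k : t_1+\cdots+t_k\in D\}.$$ Let $\mu_D$ be the minimum of $$\frac{1}{p-1}\sum_{t\in\mathcal{T}_D}S_p(r_t)$$ over all $r=(r_t)_{t\in\mathcal{T}_D}\in\{0,\ldots,q^m-1\}^{\mathcal{T}_D}$ such that $\sum_{t\in\mathcal{T}_D}r_t\equiv 0\pmod{q-1}$ and, for every $1\le i\le k$, $\sum_{t\in\mathcal{T}_D}r_t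 t_i$ is a positive multiple of $q^m-1$. Then such $r$ exist, so that $\mu_D$ is well defined, and: 1. for every $f\in\mathbb{F}_{q^m}[x_1,\ldots,x_k]$ with $\mathrm{Deg}(f)\subseteq D$, $\nu_p(N(f=y^q-y))\ge\mu_D$; 2. there is an $f\in\mathbb{F}_{q^m}[x_1,\ldots,x_k]$ with $\mathrm{Deg}(f)\subseteq D$ and $\nu_p(N(f=y^q-y))=\mu_D$. -/

import Mathlib

/-- The sum of the digits of `a` in base `p`. -/
def digitSum (p a : ℕ) : ℕ := (Nat.digits p a).sum

/-- The `p`-adic valuation of a natural number, with value `⊤` (infinity) at `0`. -/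
noncomputable def valP (p N : ℕ) : WithTop ℚ :=
  if N = 0 then ⊤ else ((padicValNat p N : ℚ) : WithTop ℚ)

/-- The set of degrees of the nonzero homogeneous parts of a polynomial. -/
def degreeSet {k : ℕ} {F : Type*} [CommSemiring F] (f : MvPolynomial (Fin k) F) : Set ℕ :=
  {d | MvPolynomial.homogeneousComponent d f ≠ 0}

/-- The number of solutions `(x, y)` in `F ^ k × F` of `f(x) = y ^ q - y`. -/
noncomputable def numSolutions {k : ℕ} {F : Type*} [CommRing F] (q : ℕ)
    (f : MvPolynomial (Fin k) F) : ℕ :=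
  Nat.card {z : (Fin k → F) × F // MvPolynomial.eval z.1 f = z.2 ^ q - z.2}

/-- The exponent vectors in `[0, Q - 1] ^ k` whose total degree lies in `D`. -/
def exponentSet (Q k : ℕ) (D : Finset ℕ) : Finset (Fin k → ℕ) :=
  (Fintype.piFinset fun _ : Fin k => Finset.Icc 0 (Q - 1)).filter fun t => ∑ i, t i ∈ D

/-- The constraints of the program, for a vector `r` indexed by the exponent vectors. -/
structure Feasible (q m k : ℕ) (D : Finset ℕ) (r : exponentSet (q ^ m) k D → ℕ) : Prop where
  le : ∀ t, r t ≤ q ^ m - 1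
  sum_modEq : ∑ t, r t ≡ 0 [MOD q - 1]
  weighted_pos : ∀ i : Fin k, 0 < ∑ t, r t * t.1 i
  weighted_dvd : ∀ i : Fin k, q ^ m - 1 ∣ ∑ t, r t * t.1 i

/-- The objective `(1 / (p - 1)) * ∑ S_p(r_t)`. -/
def objective (p Q k : ℕ) (D : Finset ℕ) (r : exponentSet Q k D → ℕ) : ℚ :=
  1 / ((p : ℚ) - 1) * ∑ t, (digitSum p (r t) : ℚ)

open Finset

/-! Write Q = q^m, let ζ be a primitive p-th root of unity in a field L receiving the Witt vectors
of F, put π = ζ - 1, and let T be the Teichmüller character and ψ(z) = ζ^(Tr z). Sizes are measured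
by a multiplicative valuation v with v(p) = v(π)^(p-1), which accounts for the factor 1/(p-1) in the
objective.

Orthogonality of characters turns the number N of solutions into the sum of ψ(a f(x)) over x and
over a with a^q = a. On F, ψ is a combination of the powers T^r, 0 ≤ r ≤ Q - 1. Up to a unit its
coefficients are Gauss sums, apart from the two extreme r, and by Stickelberger's theorem each has
size exactly v(π)^(S_p(r)) (`valuation_traceCoeff`). Multiplying out over the monomials c_t x^t of f
gives N = ∑_r A_r ∏_t T(c_t)^(r_t), where A_r contains a power sum over a and one over each x_i.
These vanish unless r satisfies the congruences, and a column sum ∑ r_t t_i equal to 0 contributes a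
factor Q instead of a unit.

Lower bound: an r satisfying the congruences may fail to be feasible because a column sum is 0 or an
exponent exceeds Q - 1. `exists_feasible` replaces it by a feasible vector of no larger cost, the
factors Q paying for the zero columns. So every A_r has size at most v(π)^M, with M the minimal
total digit sum.

Sharpness: for feasible r all power sums are units, so a minimizer r₀ has A_{r₀} of size exactly
v(π)^M. The monomial functions of c have an integral dual basis, so A_{r₀} is an integral
combination of the numbers N(f_c), which therefore cannot all be smaller than v(π)^M. -/

/-! ### Digit sums -/

theorem digitSum_zero (p : ℕ) : digitSum p 0 = 0 := by simp [digitSum]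

theorem digitSum_mul_add {p : ℕ} (hp : 1 < p) (n : ℕ) {d : ℕ} (hd : d < p) :
    digitSum p (p * n + d) = digitSum p n + d := by
  rcases Nat.eq_zero_or_pos (p * n + d) with h | h
  · obtain ⟨h1, rfl⟩ : p * n = 0 ∧ d = 0 := by omega
    have : n = 0 := by simpa [show p ≠ 0 by omega] using h1
    simp [this, digitSum]
  · unfold digitSum
    rw [Nat.digits_def' hp h, List.sum_cons, Nat.mul_add_mod, Nat.mod_eq_of_lt hd,
      Nat.mul_add_div (by omega), Nat.div_eq_of_lt hd, add_zero, add_comm]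

theorem digitSum_eq_mod_add {p : ℕ} (hp : 1 < p) (n : ℕ) :
    digitSum p n = digitSum p (n / p) + n % p := by
  conv_lhs => rw [← Nat.div_add_mod n p]
  exact digitSum_mul_add hp _ (Nat.mod_lt _ (by omega))

theorem digitSum_pow_mul_add {p : ℕ} (hp : 1 < p) (n h l : ℕ) (hl : l < p ^ n) :
    digitSum p (p ^ n * h + l) = digitSum p h + digitSum p l := by
  induction n generalizing l with
  | zero =>
    obtain rfl : l = 0 := by simpa using hl
    simp [digitSum]
  | succ n ih =>
    have hl' : l / p < p ^ n := Nat.div_lt_of_lt_mul (by rwa [pow_succ'] at hl)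
    have hmod : l % p < p := Nat.mod_lt _ (by omega)
    have : p ^ (n + 1) * h + l = p * (p ^ n * h + l / p) + l % p := by
      conv_lhs => rw [← Nat.div_add_mod l p]
      ring
    rw [this, digitSum_mul_add hp _ hmod, ih _ hl', digitSum_eq_mod_add hp l, add_assoc]

/-- Subtracting from p^n - 1 involves no borrowing: each digit d becomes p - 1 - d. -/
theorem digitSum_compl {p : ℕ} (hp : 1 < p) (n r : ℕ) (hr : r < p ^ n) :
    digitSum p r + digitSum p (p ^ n - 1 - r) = n * (p - 1) := by
  induction n generalizing r with
  | zero =>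
    obtain rfl : r = 0 := by simpa using hr
    simp [digitSum]
  | succ n ih =>
    have hr' : r / p < p ^ n := Nat.div_lt_of_lt_mul (by rwa [pow_succ'] at hr)
    have hmod : r % p < p := Nat.mod_lt _ (by omega)
    have : p ^ (n + 1) - 1 - r = p * (p ^ n - 1 - r / p) + (p - 1 - r % p) := by
      conv_lhs => rw [← Nat.div_add_mod r p, pow_succ']
      obtain ⟨c, hc⟩ : ∃ c, p ^ n = r / p + 1 + c := ⟨p ^ n - (r / p + 1), by omega⟩
      have h1 : p ^ n - 1 - r / p = c := by omega
      rw [h1, hc, mul_add, mul_add]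
      omega
    rw [this, digitSum_mul_add hp _ (by omega), digitSum_eq_mod_add hp r]
    have := ih _ hr'
    rw [add_mul, ← this]
    omega

theorem digitSum_pow_sub_one {p : ℕ} (hp : 1 < p) (n : ℕ) :
    digitSum p (p ^ n - 1) = n * (p - 1) := by
  simpa [digitSum_zero] using digitSum_compl hp n 0 (by positivity)

theorem digitSum_le_self (p n : ℕ) : digitSum p n ≤ n := Nat.digit_sum_le p n

/-- By Legendre's formula (p - 1) ν_p(n!) = n - S_p(n), this is the divisibility of (a + b)! by a!
b!. -/
theorem digitSum_add_le {p : ℕ} (hp : p.Prime) (a b : ℕ) :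
    digitSum p (a + b) ≤ digitSum p a + digitSum p b := by
  have := Fact.mk hp
  have key : ∀ n, (p - 1) * padicValNat p n.factorial = n - digitSum p n :=
    fun n => sub_one_mul_padicValNat_factorial n
  have h := Nat.factorial_mul_factorial_dvd_factorial_add a b
  have h2 := padicValNat_dvd_iff_le (p := p) (Nat.factorial_ne_zero (a + b))
    (n := padicValNat p (a.factorial * b.factorial))
  have h3 := h2.1 (pow_padicValNat_dvd.trans h)
  rw [padicValNat.mul (Nat.factorial_ne_zero _) (Nat.factorial_ne_zero _)] at h3
  have h4 := Nat.mul_le_mul_left (p - 1) h3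
  rw [mul_add, key, key, key] at h4
  have := digitSum_le_self p a
  have := digitSum_le_self p b
  have := digitSum_le_self p (a + b)
  omega

theorem digitSum_sum_le {p : ℕ} (hp : p.Prime) {ι : Type*} (s : Finset ι) (w : ι → ℕ) :
    digitSum p (∑ i ∈ s, w i) ≤ ∑ i ∈ s, digitSum p (w i) := by
  classical
  induction s using Finset.induction_on with
  | empty => simp [digitSum]
  | insert a s ha ih =>
    rw [sum_insert ha, sum_insert ha]
    exact (digitSum_add_le hp _ _).trans (by omega)

/-- Every natural number has a representative modulo `p ^ n - 1` in `[0, p ^ n - 1]`, positive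
if the number is, whose digit sum is no larger. -/
theorem exists_reduced_modEq {p : ℕ} (hp : p.Prime) {n : ℕ} (hn : 0 < n) (R : ℕ) :
    ∃ r, r ≤ p ^ n - 1 ∧ r ≤ R ∧ r ≡ R [MOD p ^ n - 1] ∧ (0 < R → 0 < r) ∧
      digitSum p r ≤ digitSum p R := by
  induction R using Nat.strong_induction_on with
  | _ R ih =>
    have hpn : 1 < p ^ n := Nat.one_lt_pow hn.ne' hp.one_lt
    by_cases hR : R < p ^ n
    · exact ⟨R, by omega, le_rfl, rfl, id, le_rfl⟩
    · have hdm := Nat.div_add_mod R (p ^ n)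
      have hh : 0 < R / p ^ n := Nat.div_pos (by omega) (by omega)
      have hl : R % p ^ n < p ^ n := Nat.mod_lt _ (by omega)
      generalize R / p ^ n = h at hdm hh
      generalize R % p ^ n = l at hdm hl
      obtain ⟨P, hP⟩ : ∃ P, p ^ n = P + 1 := ⟨p ^ n - 1, by omega⟩
      -- Since p^n ≡ 1, the number p^n h + l may be replaced by the smaller h + l, whose digit sum
      -- is at most S_p(h) + S_p(l) = S_p(R).
      have hRP : R = P * h + (h + l) := by rw [← hdm, hP]; ring
      have hPh : 0 < P * h := Nat.mul_pos (by omega) hh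
      obtain ⟨r, h1, h2, h3, h4, h5⟩ := ih (h + l) (by omega)
      refine ⟨r, h1, by omega, h3.trans ?_, fun _ => h4 (by omega), h5.trans ?_⟩
      · have hP1 : p ^ n - 1 = P := by omega
        rw [hP1, hRP]
        simp [Nat.ModEq]
      · rw [← hdm, digitSum_pow_mul_add hp.one_lt _ _ _ hl]
        exact digitSum_add_le hp _ _

/-! ### Restoring prescribed degrees after reducing exponents -/

/-- A family of rows in `[0, P] ^ k` whose row sums do not exceed prescribed values congruent to
them, and whose weighted column sums are multiples of `P`, with no zero column. -/
structure RowSystem {ι : Type*} [Fintype ι] {k : ℕ} (P : ℕ) (w d : ι → ℕ) (t : ι → Fin k → ℕ) :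
    Prop where
  le : ∀ s i, t s i ≤ P
  sum_le : ∀ s, ∑ i, t s i ≤ d s
  sum_modEq : ∀ s, ∑ i, t s i ≡ d s [MOD P]
  weighted : ∀ i, ∑ s, w s * t s i ≡ 0 [MOD P]
  pos : ∀ i, ∃ s, 0 < t s i

/-- The deficit is a multiple f P, and turning f zeros into P changes no residue. -/
theorem exists_fill_zeros {k P d : ℕ} (x : Fin k → ℕ) (hx : ∀ i, x i ≤ P)
    (hle : ∑ i, x i ≤ d) (hmod : ∑ i, x i ≡ d [MOD P])
    (hd : d ≤ ∑ i, x i + P * #{i | x i = 0}) :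
    ∃ y : Fin k → ℕ, (∀ i, x i ≤ y i) ∧ (∀ i, y i ≤ P) ∧ (∀ i, y i ≡ x i [MOD P]) ∧
      ∑ i, y i = d := by
  obtain ⟨f, hf⟩ := (Nat.modEq_iff_dvd' hle).1 hmod
  rcases Nat.eq_zero_or_pos P with rfl | hP
  · exact ⟨x, fun _ => le_rfl, hx, fun _ => rfl, by omega⟩
  have hfle : f ≤ #{i | x i = 0} := by
    refine Nat.le_of_mul_le_mul_left ?_ hP
    omega
  obtain ⟨A, hA, hAc⟩ := Finset.exists_subset_card_eq hfle
  have hA0 : ∀ i ∈ A, x i = 0 := fun i hi => by simpa using hA hi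
  refine ⟨fun i => x i + if i ∈ A then P else 0, fun i => by simp, fun i => ?_, fun i => ?_, ?_⟩
  · by_cases hi : i ∈ A
    · simp [hi, hA0 i hi]
    · simpa [hi] using hx i
  · by_cases hi : i ∈ A <;> simp [hi, Nat.ModEq]
  · rw [sum_add_distrib, sum_ite_mem, univ_inter, sum_const, hAc, smul_eq_mul, mul_comm f]
    omega

theorem weighted_sum_modEq {ι : Type*} [Fintype ι] {P : ℕ} (w : ι → ℕ) {x y : ι → ℕ}
    (h : ∀ s, x s ≡ y s [MOD P]) : ∑ s, w s * x s ≡ ∑ s, w s * y s [MOD P] := by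
  classical
  have : ∀ A : Finset ι, ∑ s ∈ A, w s * x s ≡ ∑ s ∈ A, w s * y s [MOD P] := by
    intro A
    induction A using Finset.induction_on with
    | empty => rfl
    | insert a A ha ih =>
      rw [sum_insert ha, sum_insert ha]
      exact ((h a).mul_left _).add ih
  exact this univ

/-- Adding column `j` to column `0` and refilling column `j` by a single entry `P` in a row with
enough room preserves a row system. -/
theorem RowSystem.exists_merge {ι : Type*} [Fintype ι] {k P : ℕ} {w d : ι → ℕ}
    {t : ι → Fin (k + 1) → ℕ} (h : RowSystem P w d t) (hP : 0 < P) {j : Fin (k + 1)} (hj : j ≠ 0)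
    {s₀ : ι} (hs₀ : ∑ i, t s₀ i + P ≤ d s₀) :
    ∃ t' : ι → Fin (k + 1) → ℕ, RowSystem P w d t' ∧ (∀ s, t' s j = 0 ∨ t' s j = P) ∧
      ∀ s i, i ≠ 0 → i ≠ j → t' s i = t s i := by
  classical
  let c : ι → ℕ := fun s =>
    if t s 0 + t s j ≤ P then t s 0 + t s j else t s 0 + t s j - P
  have hc : ∀ s, c s ≤ P ∧ c s ≤ t s 0 + t s j ∧ (0 < t s 0 → 0 < c s) ∧
      c s ≡ t s 0 + t s j [MOD P] := by
    intro s
    have h0 := h.le s 0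
    have h1 := h.le s j
    by_cases hs : t s 0 + t s j ≤ P
    · simp only [c, if_pos hs]
      exact ⟨hs, le_rfl, by omega, rfl⟩
    · simp only [c, if_neg hs]
      refine ⟨by omega, by omega, by omega, ?_⟩
      rw [Nat.modEq_iff_dvd' (by omega)]
      exact ⟨1, by omega⟩
  let b : ι → ℕ := fun s => if s = s₀ then P else 0
  let t' : ι → Fin (k + 1) → ℕ := fun s i => if i = 0 then c s else if i = j then b s else t s i
  have ht0 : ∀ s, t' s 0 = c s := fun s => by simp [t']
  have htj : ∀ s, t' s j = b s := fun s => by simp [t', hj]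
  have hti : ∀ s i, i ≠ 0 → i ≠ j → t' s i = t s i := fun s i h0 h1 => by simp [t', h0, h1]
  have hb : ∀ s, b s ≡ 0 [MOD P] := fun s => by
    by_cases hs : s = s₀ <;> simp [b, hs, Nat.ModEq]
  have hsplit : ∀ x : Fin (k + 1) → ℕ,
      ∑ i, x i = x 0 + x j + ∑ i ∈ (univ.erase 0).erase j, x i := by
    intro x
    rw [← add_sum_erase univ x (mem_univ 0),
      ← add_sum_erase (univ.erase 0) x (mem_erase.2 ⟨hj, mem_univ _⟩), add_assoc]
  have hrest : ∀ s, ∑ i ∈ (univ.erase 0).erase j, t' s i = ∑ i ∈ (univ.erase 0).erase j, t s i := by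
    intro s
    refine sum_congr rfl fun i hi => ?_
    simp only [mem_erase, mem_univ, and_true] at hi
    exact hti s i hi.2 hi.1
  have hsum : ∀ s, ∑ i, t' s i = c s + b s + ∑ i ∈ (univ.erase 0).erase j, t s i := by
    intro s
    rw [hsplit, ht0, htj, hrest]
  refine ⟨t', ⟨fun s i => ?_, fun s => ?_, fun s => ?_, fun i => ?_, fun i => ?_⟩, fun s => ?_, hti⟩
  · by_cases h0 : i = 0
    · rw [h0, ht0]; exact (hc s).1
    by_cases h1 : i = j
    · rw [h1, htj]
      by_cases hs : s = s₀ <;> simp [b, hs]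
    · rw [hti s i h0 h1]; exact h.le s i
  · have h1 := hsum s
    have h2 := hsplit (t s)
    have h3 := (hc s).2.1
    have h4 := h.sum_le s
    by_cases hs : s = s₀
    · subst hs
      have : b s = P := by simp [b]
      omega
    · have : b s = 0 := by simp [b, hs]
      omega
  · rw [hsum]
    refine Nat.ModEq.trans ?_ (h.sum_modEq s)
    rw [hsplit (t s)]
    simpa using (((hc s).2.2.2.add (hb s)).add_right (∑ i ∈ (univ.erase 0).erase j, t s i))
  · by_cases h0 : i = 0
    · subst h0
      simp only [ht0]
      refine (weighted_sum_modEq w fun s => (hc s).2.2.2).trans ?_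
      simp only [mul_add, sum_add_distrib]
      simpa using (h.weighted 0).add (h.weighted j)
    by_cases h1 : i = j
    · subst h1
      simp only [htj]
      simpa using weighted_sum_modEq w hb
    · simp only [hti _ i h0 h1]
      exact h.weighted i
  · by_cases h0 : i = 0
    · subst h0
      obtain ⟨s, hs⟩ := h.pos 0
      exact ⟨s, by rw [ht0]; exact (hc s).2.2.1 hs⟩
    by_cases h1 : i = j
    · subst h1
      exact ⟨s₀, by rw [htj]; simpa [b] using hP⟩
    · obtain ⟨s, hs⟩ := h.pos i
      exact ⟨s, by rwa [hti s i h0 h1]⟩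
  · rw [htj]
    by_cases hs : s = s₀ <;> simp [b, hs]

/-- If every row has enough zeros, fill them with P. Otherwise merge a further column into column 0
by `exists_merge`; the set C records the columns already merged, whose entries are all 0 or P, so
the process terminates. -/
theorem RowSystem.exists_sum_eq {ι : Type*} [Fintype ι] {k P : ℕ} {w d : ι → ℕ}
    {t : ι → Fin k → ℕ} (h : RowSystem P w d t) (hP : 0 < P) (hd : ∀ s, d s ≤ k * P) :
    ∃ t' : ι → Fin k → ℕ, RowSystem P w d t' ∧ ∀ s, ∑ i, t' s i = d s := by
  classical
  rcases k with _ | k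
  · exact ⟨t, h, fun s => le_antisymm (h.sum_le s) (by simpa using hd s)⟩
  suffices H : ∀ (n : ℕ) (C : Finset (Fin (k + 1))) (t : ι → Fin (k + 1) → ℕ), #Cᶜ = n →
      RowSystem P w d t → (∀ s, ∀ i ∈ C, i ≠ 0 → t s i = 0 ∨ t s i = P) →
      ∃ t' : ι → Fin (k + 1) → ℕ, RowSystem P w d t' ∧ ∀ s, ∑ i, t' s i = d s from
    H _ ∅ t rfl h (by simp)
  clear h t
  intro n
  induction n using Nat.strong_induction_on with
  | _ n ih =>
  intro C t hn h hC
  by_cases hfull : ∀ s, d s ≤ ∑ i, t s i + P * #{i | t s i = 0}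
  · choose y hy1 hy2 hy3 hy4 using fun s =>
      exists_fill_zeros (t s) (h.le s) (h.sum_le s) (h.sum_modEq s) (hfull s)
    refine ⟨y, ⟨hy2, fun s => (hy4 s).le, fun s => by rw [hy4], fun i => ?_, fun i => ?_⟩, hy4⟩
    · exact (weighted_sum_modEq w fun s => hy3 s i).trans (h.weighted i)
    · obtain ⟨s, hs⟩ := h.pos i
      exact ⟨s, hs.trans_le (hy1 s i)⟩
  push Not at hfull
  obtain ⟨s₀, hs₀⟩ := hfull
  -- The two sides are congruent mod P, so a strict inequality leaves room for a whole extra P.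
  have hroom : ∑ i, t s₀ i + P * #{i | t s₀ i = 0} + P ≤ d s₀ := by
    refine Nat.ModEq.add_le_of_lt ?_ hs₀
    refine Nat.ModEq.trans ?_ (h.sum_modEq s₀)
    simp [Nat.ModEq]
  by_cases hex : ∃ j, j ∉ C ∧ j ≠ 0
  · obtain ⟨j, hjC, hj⟩ := hex
    obtain ⟨t', h1, h2, h3⟩ := h.exists_merge hP hj (s₀ := s₀) (by omega)
    refine ih #(insert j C)ᶜ ?_ (insert j C) t' rfl h1 fun s i hi hi0 => ?_
    · rw [← hn]
      exact card_lt_card (compl_ssubset_compl.2 (ssubset_insert hjC))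
    · by_cases hij : i = j
      · rw [hij]
        exact h2 s
      · rw [h3 s i hi0 hij]
        exact hC s i ((mem_insert.1 hi).resolve_left hij) hi0
  · push Not at hex
    exfalso
    -- With all columns but 0 merged, filling the zeros of row `s₀` gives P in those k columns and
    -- something positive in column 0; a further P would then exceed (k + 1) P ≥ d.
    have hterm : ∀ i, i ≠ 0 → P ≤ t s₀ i + if t s₀ i = 0 then P else 0 := by
      intro i hi
      have hiC : i ∈ C := by by_contra hc; exact hi (hex i hc)
      rcases hC s₀ i hiC hi with h0 | h0 <;> simp [h0]
    have hsum : ∑ i, t s₀ i + P * #{i | t s₀ i = 0} =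
        ∑ i, (t s₀ i + if t s₀ i = 0 then P else 0) := by
      rw [sum_add_distrib, ← sum_filter, sum_const, smul_eq_mul, mul_comm P]
    rw [hsum, Fin.sum_univ_succ] at hroom
    have h1 : k * P ≤ ∑ i : Fin k, (t s₀ i.succ + if t s₀ i.succ = 0 then P else 0) := by
      simpa using card_nsmul_le_sum (univ : Finset (Fin k)) _ P
        fun i _ => hterm i.succ (Fin.succ_ne_zero i)
    have h2 : 0 < t s₀ 0 + if t s₀ 0 = 0 then P else 0 := by
      split_ifs <;> omega
    have h3 := hd s₀
    rw [add_mul, one_mul] at h3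
    omega

/-! ### From congruences to feasible vectors -/

/-- Rows with row sums in `D` and weights satisfying the congruences, with no zero weighted column
sum, can be collected into a feasible vector without increasing the digit sums. -/
theorem exists_feasible_of_pos {p e q m k : ℕ} (hp : p.Prime) (he : 0 < e) (hq : q = p ^ e)
    (hm : 0 < m) {D : Finset ℕ} (hD : D ⊆ Icc 0 (k * (q ^ m - 1))) {ι : Type*} [Fintype ι]
    (w : ι → ℕ) (t : ι → Fin k → ℕ) (ht : ∀ s, ∑ i, t s i ∈ D) (hw : ∀ s, 0 < w s)
    (hsum : ∑ s, w s ≡ 0 [MOD q - 1]) (hcol : ∀ i, ∑ s, w s * t s i ≡ 0 [MOD q ^ m - 1])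
    (hpos : ∀ i, ∃ s, 0 < t s i) :
    ∃ r, Feasible q m k D r ∧ ∑ x, digitSum p (r x) ≤ ∑ s, digitSum p (w s) := by
  classical
  have hqm : q ^ m = p ^ (e * m) := by rw [hq, pow_mul]
  have hem : 0 < e * m := Nat.mul_pos he hm
  have hP : 0 < q ^ m - 1 := by
    have := Nat.one_lt_pow hem.ne' hp.one_lt
    omega
  have hdvd : q - 1 ∣ q ^ m - 1 := by simpa using Nat.sub_dvd_pow_sub_pow q 1 m
  have hred := fun R => exists_reduced_modEq hp hem R
  rw [← hqm] at hred
  choose red hred1 hred2 hred3 hred4 hred5 using hred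
  -- Reducing the exponents into [0, Q - 1] may lower the degrees out of D;
  -- `RowSystem.exists_sum_eq` restores them.
  have hsys : RowSystem (q ^ m - 1) w (fun s => ∑ i, t s i) (fun s i => red (t s i)) := by
    refine ⟨fun s i => hred1 _, fun s => sum_le_sum fun i _ => hred2 _, fun s => ?_, fun i => ?_,
      fun i => ?_⟩
    · simpa using weighted_sum_modEq (fun _ : Fin k => 1) fun i => hred3 (t s i)
    · exact (weighted_sum_modEq w fun s => hred3 (t s i)).trans (hcol i)
    · obtain ⟨s, hs⟩ := hpos i
      exact ⟨s, hred4 _ hs⟩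
  obtain ⟨t', h', hs'⟩ := hsys.exists_sum_eq hP fun s => (mem_Icc.1 (hD (ht s))).2
  have hmem : ∀ s, t' s ∈ exponentSet (q ^ m) k D := by
    intro s
    rw [exponentSet, mem_filter, Fintype.mem_piFinset, hs']
    exact ⟨fun i => mem_Icc.2 ⟨Nat.zero_le _, h'.le s i⟩, ht s⟩
  let g : ι → exponentSet (q ^ m) k D := fun s => ⟨t' s, hmem s⟩
  -- Distinct rows may have become equal, so their weights are added; subadditivity of digit sums
  -- keeps the cost down.
  let R : exponentSet (q ^ m) k D → ℕ := fun x => ∑ s with g s = x, w s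
  have hR : ∀ φ : exponentSet (q ^ m) k D → ℕ, ∑ x, R x * φ x = ∑ s, w s * φ (g s) := by
    intro φ
    rw [← sum_fiberwise univ g fun s => w s * φ (g s)]
    refine sum_congr rfl fun x _ => ?_
    rw [sum_mul]
    refine sum_congr rfl fun s hs => ?_
    rw [(mem_filter.1 hs).2]
  have hcong : ∀ φ : exponentSet (q ^ m) k D → ℕ,
      ∑ x, red (R x) * φ x ≡ ∑ s, w s * φ (g s) [MOD q ^ m - 1] := by
    intro φ
    rw [← hR]
    simpa only [mul_comm] using weighted_sum_modEq φ fun x => hred3 (R x)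
  refine ⟨fun x => red (R x), ⟨fun x => hred1 _, ?_, fun i => ?_, fun i => ?_⟩, ?_⟩
  · refine Nat.ModEq.trans ?_ hsum
    simpa using (hcong fun _ => 1).of_dvd hdvd
  · obtain ⟨s, hs⟩ := h'.pos i
    refine sum_pos' (fun _ _ => Nat.zero_le _) ⟨g s, mem_univ _, Nat.mul_pos (hred4 _ ?_) hs⟩
    exact sum_pos' (fun _ _ => Nat.zero_le _) ⟨s, by simp, hw s⟩
  · exact (Nat.modEq_zero_iff_dvd).1 ((hcong fun x => x.1 i).trans (h'.weighted i))
  · calc ∑ x, digitSum p (red (R x)) ≤ ∑ x, ∑ s with g s = x, digitSum p (w s) :=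
          sum_le_sum fun x _ => (hred5 _).trans (digitSum_sum_le hp _ _)
      _ = ∑ s, digitSum p (w s) := sum_fiberwise univ g _

/-- For each zero column i a row d e_i of weight Q - 1 is added, with 0 < d ∈ D. It disturbs no
congruence and costs S_p(Q - 1) = e m (p - 1), exactly the exponent of v(π) in the factor Q which
that column contributes to the expansion of N. The entries of `t` are not bounded by Q - 1. -/
theorem exists_feasible {p e q m k : ℕ} (hp : p.Prime) (he : 0 < e) (hq : q = p ^ e)
    (hm : 0 < m) {D : Finset ℕ} (hD : D ⊆ Icc 0 (k * (q ^ m - 1)))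
    (hDpos : ∃ d ∈ D, 0 < d) {ι : Type*} [Fintype ι]
    (w : ι → ℕ) (t : ι → Fin k → ℕ) (ht : ∀ s, ∑ i, t s i ∈ D)
    (hsum : ∑ s, w s ≡ 0 [MOD q - 1]) (hcol : ∀ i, ∑ s, w s * t s i ≡ 0 [MOD q ^ m - 1]) :
    ∃ r, Feasible q m k D r ∧ ∑ x, digitSum p (r x) ≤
      ∑ s, digitSum p (w s) + #{i | ∑ s, w s * t s i = 0} * (e * m * (p - 1)) := by
  classical
  obtain ⟨d, hdD, hd⟩ := hDpos
  have hqm : q ^ m = p ^ (e * m) := by rw [hq, pow_mul]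
  have hP : 0 < q ^ m - 1 := by
    have := Nat.one_lt_pow (Nat.mul_pos he hm).ne' hp.one_lt
    omega
  have hdvd : q - 1 ∣ q ^ m - 1 := by simpa using Nat.sub_dvd_pow_sub_pow q 1 m
  have hsub : ∀ φ : ι → ℕ, (∀ s, w s = 0 → φ s = 0) → ∑ s : {s // 0 < w s}, φ s = ∑ s, φ s := by
    intro φ hφ
    rw [← sum_filter_of_ne (p := fun s => 0 < w s) (s := univ) (f := φ)
      fun s _ hs => Nat.pos_of_ne_zero fun h => hs (hφ s h)]
    exact (sum_subtype _ (by simp) φ).symm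
  let w' : {s // 0 < w s} ⊕ {i // ∑ s, w s * t s i = 0} → ℕ :=
    Sum.elim (fun s => w s) fun _ => q ^ m - 1
  let t' : {s // 0 < w s} ⊕ {i // ∑ s, w s * t s i = 0} → Fin k → ℕ :=
    Sum.elim (fun s => t s) fun i => Pi.single i.1 d
  have key : ∃ r, Feasible q m k D r ∧ ∑ x, digitSum p (r x) ≤ ∑ s, digitSum p (w' s) := by
    refine exists_feasible_of_pos hp he hq hm hD w' t' ?_ ?_ ?_ ?_ ?_
    · rintro (s | i)
      · exact ht s
      · simpa [t'] using hdD
    · rintro (s | i)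
      · exact s.2
      · exact hP
    · simp only [w', Fintype.sum_sum_type, Sum.elim_inl, Sum.elim_inr, sum_const, smul_eq_mul]
      rw [hsub w fun _ h => h]
      simpa using hsum.add ((Nat.modEq_zero_iff_dvd).2 (hdvd.mul_left _))
    · intro i
      simp only [w', t', Fintype.sum_sum_type, Sum.elim_inl, Sum.elim_inr]
      rw [hsub (fun s => w s * t s i) fun s hs => by simp [hs], ← mul_sum]
      exact (hcol i).add ((Nat.modEq_zero_iff_dvd).2 (dvd_mul_right (q ^ m - 1) _))
    · intro i
      by_cases hi : ∑ s, w s * t s i = 0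
      · exact ⟨Sum.inr ⟨i, hi⟩, by simpa [t'] using hd⟩
      · obtain ⟨s, -, hs⟩ := exists_ne_zero_of_sum_ne_zero hi
        obtain ⟨h1, h2⟩ := Nat.mul_ne_zero_iff.1 hs
        exact ⟨Sum.inl ⟨s, Nat.pos_of_ne_zero h1⟩, Nat.pos_of_ne_zero h2⟩
  obtain ⟨r, hr, hle⟩ := key
  refine ⟨r, hr, hle.trans (le_of_eq ?_)⟩
  simp only [w', Fintype.sum_sum_type, Sum.elim_inl, Sum.elim_inr, sum_const, smul_eq_mul]
  rw [hsub (fun s => digitSum p (w s)) (by intro s hs; simp [hs, digitSum_zero]), hqm,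
    digitSum_pow_sub_one hp.one_lt, card_univ, Fintype.card_subtype]

/-! ### A p-adic valuation on an algebraic closure of the fraction field of the Witt vectors -/

/-- A valuation on a field that receives the Witt vectors of `F`, integral on them and restricting
to a nontrivial `p`-adic valuation. -/
structure IsWittValuation {p : ℕ} [Fact p.Prime] {F : Type*} [Field F] {L : Type*} [Field L]
    {Γ₀ : Type*} [LinearOrderedCommGroupWithZero Γ₀] (v : Valuation L Γ₀)
    (j : WittVector p F →+* L) : Prop where
  le_one : ∀ w, v (j w) ≤ 1
  natCast_lt_one : v (p : L) < 1
  natCast_ne_zero : (p : L) ≠ 0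

theorem exists_isWittValuation.{u} (p : ℕ) [Fact p.Prime] (F : Type u) [Field F] [CharP F p] :
    ∃ (L : Type u) (_ : Field L) (Γ₀ : Type u) (_ : LinearOrderedCommGroupWithZero Γ₀)
      (v : Valuation L Γ₀) (j : WittVector p F →+* L) (ζ : L),
      IsWittValuation v j ∧ IsPrimitiveRoot ζ p := by
  let K := FractionRing (WittVector p F)
  let L := AlgebraicClosure K
  let j : WittVector p F →+* L := (algebraMap K L).comp (algebraMap _ K)
  have hj : Function.Injective j :=
    (algebraMap K L).injective.comp (IsFractionRing.injective (WittVector p F) K)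
  have hp0 : (p : L) ≠ 0 := by
    have h : (p : WittVector p F) ≠ 0 := (WittVector.irreducible p).ne_zero
    have h2 := (map_ne_zero_iff j hj).2 h
    rwa [map_natCast] at h2
  have hI : Ideal.span {(p : j.range)} ≠ ⊤ := by
    rw [Ne, Ideal.span_singleton_eq_top]
    intro hu
    let e := RingEquiv.ofBijective j.rangeRestrict
      ⟨fun a b h => hj (congrArg Subtype.val h), j.rangeRestrict_surjective⟩
    have h2 : IsUnit (e.symm (p : j.range)) := hu.map e.symm
    rw [map_natCast] at h2
    exact (WittVector.irreducible (k := F) p).not_isUnit h2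
  -- Any valuation ring containing the image of the Witt vectors with p as a nonunit will do;
  -- discreteness and uniqueness play no role.
  obtain ⟨V, hV1, hV2⟩ := Ideal.image_subset_nonunits_valuationSubring _ hI
  have : NeZero (p : L) := ⟨hp0⟩
  obtain ⟨ζ, hζ⟩ := IsAlgClosed.exists_root (Polynomial.cyclotomic p L)
    (Polynomial.degree_cyclotomic_pos p L (Fact.out : p.Prime).pos).ne'
  refine ⟨L, inferInstance, _, inferInstance, V.valuation, j, ζ, ⟨fun w => ?_, ?_, hp0⟩,
    Polynomial.isRoot_cyclotomic_iff.1 hζ⟩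
  · rw [ValuationSubring.valuation_le_one_iff]
    exact hV1 ⟨w, rfl⟩
  · have := hV2 ⟨(p : j.range), Ideal.subset_span rfl, rfl⟩
    rw [SetLike.mem_coe, ValuationSubring.mem_nonunits_iff] at this
    simpa using this

/-- The Teichmüller lift, with values in a field receiving the Witt vectors. -/
noncomputable def teich {p : ℕ} [Fact p.Prime] {F : Type*} [Field F] {L : Type*} [Field L]
    (j : WittVector p F →+* L) : MulChar F L where
  toFun z := j (WittVector.teichmuller p z)
  map_one' := by simp
  map_mul' := by simp
  map_nonunit' z hz := by
    have : z = 0 := by simpa using hz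
    simp [this]

/-! ### The Teichmüller character and its power sums -/

section Teichmuller

variable {p : ℕ} [Fact p.Prime] {F : Type*} [Field F] {L : Type*} [Field L]
  {Γ₀ : Type*} [LinearOrderedCommGroupWithZero Γ₀] {v : Valuation L Γ₀}
  {j : WittVector p F →+* L}

theorem teich_apply (z : F) : teich j z = j (WittVector.teichmuller p z) := rfl

theorem teich_sum {ι : Type*} (s : Finset ι) (f : ι → F) (w : ι → WittVector p F) :
    ∑ i ∈ s, teich j (f i) * j (w i) = j (∑ i ∈ s, WittVector.teichmuller p (f i) * w i) := by
  simp [teich_apply]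

theorem valuation_sum_le_one {ι : Type*} (s : Finset ι) (f : ι → L) (h : ∀ i ∈ s, v (f i) ≤ 1) :
    v (∑ i ∈ s, f i) ≤ 1 := v.map_sum_le h

theorem valuation_eq_one_of_pow_eq_one {x : L} {n : ℕ} (hn : n ≠ 0) (h : x ^ n = 1) :
    v x = 1 := by
  have : v x ^ n = 1 := by rw [← map_pow, h, map_one]
  exact (pow_eq_one_iff_of_nonneg zero_le hn).1 this

theorem natCast_coeff_zero (n : ℕ) : (n : WittVector p F).coeff 0 = (n : F) :=
  map_natCast (WittVector.constantCoeff (p := p) (R := F)) n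

theorem IsWittValuation.natCast_le_one (hv : IsWittValuation v j) (n : ℕ) : v (n : L) ≤ 1 := by
  rw [← map_natCast j n]
  exact hv.le_one _

theorem IsWittValuation.teich_le_one (hv : IsWittValuation v j) (z : F) : v (teich j z) ≤ 1 :=
  hv.le_one _

variable [CharP F p]

/-- A Witt vector with nonzero residue is a unit, and both it and its inverse are integral. -/
theorem IsWittValuation.eq_one (hv : IsWittValuation v j) {w : WittVector p F}
    (hw : w.coeff 0 ≠ 0) : v (j w) = 1 := by
  obtain ⟨u, rfl⟩ := WittVector.isUnit_of_coeff_zero_ne_zero w hw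
  refine le_antisymm (hv.le_one _) ?_
  have h1 := hv.le_one (↑u⁻¹ : WittVector p F)
  have h2 : v (j u) * v (j (↑u⁻¹ : WittVector p F)) = 1 := by
    rw [← map_mul, ← map_mul, Units.mul_inv, map_one, map_one]
  calc 1 = v (j u) * v (j (↑u⁻¹ : WittVector p F)) := h2.symm
    _ ≤ v (j u) * 1 := mul_le_mul_right h1 _
    _ = v (j u) := mul_one _

theorem IsWittValuation.natCast_eq_one (hv : IsWittValuation v j) {n : ℕ} (hn : ¬ p ∣ n) :
    v (n : L) = 1 := by
  rw [← map_natCast j n]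
  refine hv.eq_one ?_
  rw [natCast_coeff_zero]
  rwa [Ne, CharP.cast_eq_zero_iff F p]

theorem IsWittValuation.teich_injective (hv : IsWittValuation v j) :
    Function.Injective (teich j) := by
  intro z w h
  by_contra hne
  have h1 : v (j (WittVector.teichmuller p z - WittVector.teichmuller p w)) = 1 := by
    refine hv.eq_one ?_
    have := map_sub (WittVector.constantCoeff (p := p) (R := F)) (WittVector.teichmuller p z)
      (WittVector.teichmuller p w)
    simp only [WittVector.constantCoeff_apply, WittVector.teichmuller_coeff_zero] at this
    rw [this]
    exact sub_ne_zero.2 hne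
  rw [map_sub, ← teich_apply, ← teich_apply, h, sub_self, map_zero] at h1
  exact zero_ne_one h1

variable [Fintype F]

theorem FiniteField.pow_eq_pow_iff_forall {r s : ℕ} :
    (∀ z : Fˣ, z ^ r = z ^ s) ↔ r ≡ s [MOD Fintype.card F - 1] := by
  classical
  obtain ⟨g, hg⟩ := IsCyclic.exists_generator (α := Fˣ)
  have ho : orderOf g = Fintype.card F - 1 := by
    rw [orderOf_eq_card_of_forall_mem_zpowers hg, Nat.card_eq_fintype_card, Fintype.card_units]
  constructor
  · intro h
    rw [← ho]
    exact pow_eq_pow_iff_modEq.1 (h g)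
  · intro h z
    rw [pow_eq_pow_iff_modEq]
    refine h.of_dvd ?_
    rw [← Fintype.card_units]
    exact orderOf_dvd_card

theorem IsWittValuation.teich_pow_eq_pow_iff (hv : IsWittValuation v j) {r s : ℕ} :
    teich j ^ r = teich j ^ s ↔ r ≡ s [MOD Fintype.card F - 1] := by
  rw [← FiniteField.pow_eq_pow_iff_forall, MulChar.ext_iff]
  refine forall_congr' fun z => ?_
  rw [MulChar.pow_apply_coe, MulChar.pow_apply_coe, ← map_pow, ← map_pow,
    hv.teich_injective.eq_iff, ← Units.val_pow_eq_pow_val, ← Units.val_pow_eq_pow_val,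
    Units.val_inj]

theorem IsWittValuation.teich_pow_eq_one_iff (hv : IsWittValuation v j) {r : ℕ} :
    teich j ^ r = 1 ↔ Fintype.card F - 1 ∣ r := by
  rw [← pow_zero (teich j), hv.teich_pow_eq_pow_iff, Nat.modEq_zero_iff_dvd]

theorem MulChar.sum_one_eq_card_sub_one :
    ∑ a, (1 : MulChar F L) a = ((Fintype.card F - 1 : ℕ) : L) := by
  classical
  rw [MulChar.sum_one_eq_card_units, Fintype.card_units]

/-- The power sums of the Teichmüller representatives. -/
theorem IsWittValuation.sum_teich_pow (hv : IsWittValuation v j) (u : ℕ) :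
    ∑ z, teich j z ^ u = if u = 0 then (Fintype.card F : L) else
      if Fintype.card F - 1 ∣ u then ((Fintype.card F - 1 : ℕ) : L) else 0 := by
  split_ifs with h0 h1
  -- Here 0 ^ 0 = 1, so u = 0 gives Q and not Q - 1; this is why feasibility asks for positive
  -- column sums.
  · simp [h0]
  · simp_rw [← MulChar.pow_apply' _ h0]
    rw [hv.teich_pow_eq_one_iff.2 h1, MulChar.sum_one_eq_card_sub_one]
  · simp_rw [← MulChar.pow_apply' _ h0]
    exact MulChar.sum_eq_zero_of_ne_one fun h => h1 (hv.teich_pow_eq_one_iff.1 h)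

theorem IsWittValuation.card_sub_one_eq_one (hv : IsWittValuation v j) :
    v ((Fintype.card F - 1 : ℕ) : L) = 1 := by
  refine hv.natCast_eq_one fun h => ?_
  have h1 : p ∣ Fintype.card F := by
    rw [← CharP.cast_eq_zero_iff F p]
    exact FiniteField.cast_card_eq_zero F
  have h2 : 0 < Fintype.card F := Fintype.card_pos
  have h3 := (Nat.dvd_sub h1 h)
  rw [Nat.sub_sub_self h2] at h3
  exact (Fact.out : p.Prime).one_lt.ne' (Nat.dvd_one.1 h3)

end Teichmuller

/-! ### The size of ζ - 1 -/

section PrimitiveRoot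

variable {p : ℕ} [Fact p.Prime] {L : Type*} [Field L]
  {Γ₀ : Type*} [LinearOrderedCommGroupWithZero Γ₀] {v : Valuation L Γ₀}

theorem valuation_pow_sub_one_le {x : L} (hx : v x ≤ 1) (n : ℕ) : v (x ^ n - 1) ≤ v (x - 1) := by
  rw [← mul_geom_sum, map_mul]
  refine mul_le_of_le_one_right' (valuation_sum_le_one _ _ fun i _ => ?_)
  rw [map_pow]
  exact pow_le_one₀ zero_le hx

/-- Here p = Φ_p(1) is the product of the p - 1 factors 1 - μ, all of the same size because
primitive roots are powers of one another. -/
theorem valuation_natCast_eq_pow {ζ : L} (hζ : IsPrimitiveRoot ζ p) :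
    v (p : L) = v (ζ - 1) ^ (p - 1) := by
  have hp : p.Prime := Fact.out
  have h1 : ∀ μ : L, IsPrimitiveRoot μ p → v μ ≤ 1 := fun μ hμ =>
    (valuation_eq_one_of_pow_eq_one hp.ne_zero hμ.pow_eq_one).le
  have h2 : ∀ μ μ' : L, IsPrimitiveRoot μ p → IsPrimitiveRoot μ' p → v (μ - 1) ≤ v (μ' - 1) := by
    intro μ μ' hμ hμ'
    obtain ⟨i, -, rfl⟩ := hμ'.eq_pow_of_pow_eq_one hμ.pow_eq_one
    exact valuation_pow_sub_one_le (h1 _ hμ') i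
  have h3 := Polynomial.eval_one_cyclotomic_prime (R := L) (p := p)
  rw [Polynomial.cyclotomic_eq_prod_X_sub_primitiveRoots hζ, Polynomial.eval_prod] at h3
  rw [← h3, map_prod, prod_congr rfl (g := fun _ => v (ζ - 1)), prod_const, hζ.card_primitiveRoots,
    Nat.totient_prime hp]
  intro μ hμ
  have hμ' := isPrimitiveRoot_of_mem_primitiveRoots hμ
  rw [Polynomial.eval_sub, Polynomial.eval_X, Polynomial.eval_C, Valuation.map_sub_swap]
  exact le_antisymm (h2 _ _ hμ' hζ) (h2 _ _ hζ hμ')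

end PrimitiveRoot

/-! ### The additive character of the trace -/

section TraceChar

variable {p : ℕ} [Fact p.Prime] {F : Type*} [Field F] [Algebra (ZMod p) F]
  {L : Type*} [Field L] {ζ : L}

/-- The additive character `z ↦ ζ ^ Tr z`. -/
noncomputable def traceChar (F : Type*) [Field F] [Algebra (ZMod p) F]
    (hζ : IsPrimitiveRoot ζ p) : AddChar F L :=
  (AddChar.zmodChar p hζ.pow_eq_one).compAddMonoidHom (Algebra.trace (ZMod p) F).toAddMonoidHom

theorem traceChar_apply (hζ : IsPrimitiveRoot ζ p) (z : F) :
    traceChar F hζ z = ζ ^ (Algebra.trace (ZMod p) F z).val := rfl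

variable [Fintype F]

theorem traceChar_ne_one (hζ : IsPrimitiveRoot ζ p) : traceChar F hζ ≠ 1 := by
  intro h
  refine Algebra.trace_ne_zero (ZMod p) F (LinearMap.ext fun z => ?_)
  have h1 : traceChar F hζ z = 1 := by rw [h, AddChar.one_apply]
  rw [traceChar_apply, hζ.pow_eq_one_iff_dvd] at h1
  have h2 := Nat.eq_zero_of_dvd_of_lt h1 (ZMod.val_lt _)
  simpa using h2

theorem traceChar_isPrimitive (hζ : IsPrimitiveRoot ζ p) : (traceChar F hζ).IsPrimitive :=
  AddChar.IsPrimitive.of_ne_one (traceChar_ne_one hζ)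

/-- With Tr z = ∑ z^(p^i), the sum of z^(p^i - 1) over units vanishes for i > 0, as 0 < p^i - 1 < #F
- 1; the term i = 0 gives -1. -/
theorem sum_inv_mul_trace :
    ∑ z : F, z⁻¹ * ((Algebra.trace (ZMod p) F z).val : F) = -1 := by
  classical
  have hp : p.Prime := Fact.out
  have hcard : Fintype.card F = p ^ Module.finrank (ZMod p) F := by
    rw [Module.card_eq_pow_finrank (K := ZMod p) (V := F), ZMod.card]
  have h1 : ∀ z : F, ((Algebra.trace (ZMod p) F z).val : F) =
      ∑ i ∈ range (Module.finrank (ZMod p) F), z ^ p ^ i := by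
    intro z
    have := FiniteField.algebraMap_trace_eq_sum_pow (ZMod p) F z
    rw [Nat.card_zmod] at this
    rw [← this]
    conv_rhs => rw [← ZMod.natCast_zmod_val (Algebra.trace (ZMod p) F z), map_natCast]
  have h2 : ∀ i, ∑ z : F, z⁻¹ * z ^ p ^ i = ∑ z : Fˣ, (z ^ (p ^ i - 1) : F) := by
    intro i
    have h3 : ∑ z : F, z⁻¹ * z ^ p ^ i = ∑ z : {z : F // z ≠ 0}, (z : F)⁻¹ * z ^ p ^ i := by
      rw [← sum_filter_of_ne (p := fun z : F => z ≠ 0) (s := univ)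
        fun z _ hz h => hz (by simp [h])]
      exact sum_subtype _ (by simp) _
    rw [h3, ← Equiv.sum_comp unitsEquivNeZero]
    refine sum_congr rfl fun z _ => ?_
    rw [unitsEquivNeZero_apply_coe, ← pow_sub_one_mul (pow_pos hp.pos i).ne' (z : F), mul_comm,
      mul_assoc, mul_inv_cancel₀ z.ne_zero, mul_one]
  simp_rw [h1, mul_sum]
  rw [sum_comm]
  simp_rw [h2, FiniteField.sum_pow_units, hcard]
  have hn : 0 < Module.finrank (ZMod p) F := Module.finrank_pos
  rw [sum_eq_single_of_mem 0 (mem_range.2 hn)]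
  · simp
  · intro i hi hi0
    rw [if_neg]
    intro h
    have h4 : p ^ i < p ^ Module.finrank (ZMod p) F :=
      Nat.pow_lt_pow_right hp.one_lt (mem_range.1 hi)
    have h5 : 1 < p ^ i := Nat.one_lt_pow hi0 hp.one_lt
    have := Nat.le_of_dvd (by omega) h
    omega

variable [CharP F p]

theorem traceChar_pow_char (hζ : IsPrimitiveRoot ζ p) (z : F) :
    traceChar F hζ (z ^ p) = traceChar F hζ z := by
  rw [traceChar_apply, traceChar_apply]
  have := Algebra.trace_eq_of_algEquiv (FiniteField.frobeniusAlgEquiv (ZMod p) F p) z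
  rw [FiniteField.frobeniusAlgEquiv_apply, ZMod.card] at this
  rw [this]

theorem traceChar_pow_char_pow (hζ : IsPrimitiveRoot ζ p) (n : ℕ) (z : F) :
    traceChar F hζ (z ^ p ^ n) = traceChar F hζ z := by
  induction n with
  | zero => simp
  | succ n ih => rw [pow_succ, pow_mul, traceChar_pow_char, ih]

end TraceChar

/-! ### Stickelberger's theorem -/

section Stickelberger

variable {p : ℕ} [Fact p.Prime] {F : Type*} [Field F]
  {L : Type*} [Field L] {Γ₀ : Type*} [LinearOrderedCommGroupWithZero Γ₀] {v : Valuation L Γ₀}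
  {j : WittVector p F →+* L} {ζ : L}

theorem IsWittValuation.sub_one_lt_one (hv : IsWittValuation v j) (hζ : IsPrimitiveRoot ζ p) :
    v (ζ - 1) < 1 := by
  by_contra h
  have h1 := hv.natCast_lt_one
  rw [valuation_natCast_eq_pow hζ] at h1
  exact h1.not_ge (one_le_pow₀ (not_lt.1 h))

theorem valuation_sub_one_pos (hζ : IsPrimitiveRoot ζ p) :
    0 < v (ζ - 1) := by
  rw [Valuation.pos_iff]
  exact sub_ne_zero.2 (hζ.ne_one (Fact.out : p.Prime).one_lt)

theorem valuation_root_eq_one (hζ : IsPrimitiveRoot ζ p) : v ζ = 1 :=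
  valuation_eq_one_of_pow_eq_one (Fact.out : p.Prime).ne_zero hζ.pow_eq_one

theorem inv_teich_apply (z : F) : (teich j)⁻¹ z = teich j z⁻¹ :=
  MulChar.inv_apply' _ _

theorem IsWittValuation.inv_teich_pow_le_one (hv : IsWittValuation v j) (r : ℕ) (z : F) :
    v (((teich j)⁻¹ ^ r) z) ≤ 1 := by
  by_cases hz : z = 0
  · rw [hz, MulChar.map_zero, map_zero]
    exact zero_le
  · have : ((teich j)⁻¹ ^ r) z = (teich j z⁻¹) ^ r := by
      rw [← inv_teich_apply]
      exact MulChar.pow_apply_coe _ r (Units.mk0 z hz)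
    rw [this, map_pow]
    exact pow_le_one₀ zero_le (hv.teich_le_one _)

variable [Fintype F] [CharP F p]

theorem IsWittValuation.inv_teich_pow_eq_one_iff (hv : IsWittValuation v j) {r : ℕ} :
    (teich j)⁻¹ ^ r = 1 ↔ Fintype.card F - 1 ∣ r := by
  rw [inv_pow, inv_eq_one, hv.teich_pow_eq_one_iff]

variable [Algebra (ZMod p) F]

theorem gaussSum_inv_teich_pow_char_mul (hζ : IsPrimitiveRoot ζ p) {r : ℕ} (hr : 0 < r) :
    gaussSum ((teich j)⁻¹ ^ (p * r)) (traceChar F hζ) =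
      gaussSum ((teich j)⁻¹ ^ r) (traceChar F hζ) := by
  have hp : p.Prime := Fact.out
  unfold gaussSum
  refine Fintype.sum_equiv (frobeniusEquiv F p).toEquiv _ _ fun z => ?_
  change _ = ((teich j)⁻¹ ^ r) (z ^ p) * traceChar F hζ (z ^ p)
  rw [traceChar_pow_char, MulChar.pow_apply' _ hr.ne',
    MulChar.pow_apply' _ (Nat.mul_pos hp.pos hr).ne', map_pow, pow_mul]

/-- Expand ζ^n = 1 + nπ + O(π²). The constant term sums to 0, the character being nontrivial for #F
> 2, and the coefficient of π reduces to ∑ z⁻¹ Tr z = -1, a unit. -/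
theorem IsWittValuation.gaussSum_inv_teich (hv : IsWittValuation v j) (hζ : IsPrimitiveRoot ζ p)
    (hF : 2 < Fintype.card F) :
    v (gaussSum (teich j)⁻¹ (traceChar F hζ)) = v (ζ - 1) := by
  let n : F → ℕ := fun z => (Algebra.trace (ZMod p) F z).val
  let b : F → L := fun z => ∑ i ∈ range (n z), ∑ l ∈ range i, ζ ^ l
  have hb : ∀ z, ζ ^ n z = 1 + (ζ - 1) * (n z + (ζ - 1) * b z) := by
    intro z
    have h1 : ∀ i, ζ ^ i = 1 + (ζ - 1) * ∑ l ∈ range i, ζ ^ l := by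
      intro i
      rw [mul_geom_sum]
      ring
    have h2 : ∑ i ∈ range (n z), ζ ^ i = n z + (ζ - 1) * b z := by
      rw [mul_sum, sum_congr rfl fun i _ => h1 i, sum_add_distrib]
      simp
    rw [← h2]
    exact h1 _
  have h0 : ∑ z, (teich j)⁻¹ z = 0 := by
    refine MulChar.sum_eq_zero_of_ne_one fun h => ?_
    rw [← pow_one (teich j)⁻¹, hv.inv_teich_pow_eq_one_iff, Nat.dvd_one] at h
    omega
  have hsum : gaussSum (teich j)⁻¹ (traceChar F hζ) =
      (ζ - 1) * (∑ z, teich j z⁻¹ * j (n z) + (ζ - 1) * ∑ z, teich j z⁻¹ * b z) := by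
    have h1 : ∀ z, (teich j)⁻¹ z * traceChar F hζ z = (teich j)⁻¹ z +
        (ζ - 1) * (teich j z⁻¹ * j (n z) + (ζ - 1) * (teich j z⁻¹ * b z)) := by
      intro z
      rw [traceChar_apply, hb z, inv_teich_apply, map_natCast]
      ring
    unfold gaussSum
    rw [sum_congr rfl fun z _ => h1 z, sum_add_distrib, h0, zero_add, ← mul_sum, sum_add_distrib,
      ← mul_sum]
  have hunit : v (∑ z, teich j z⁻¹ * j (n z)) = 1 := by
    rw [teich_sum]
    refine hv.eq_one ?_
    have h1 : (∑ z, WittVector.teichmuller p z⁻¹ * (n z : WittVector p F)).coeff 0 = -1 := by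
      rw [← WittVector.constantCoeff_apply, map_sum, ← sum_inv_mul_trace (p := p) (F := F)]
      refine sum_congr rfl fun z _ => ?_
      rw [map_mul, map_natCast, WittVector.constantCoeff_apply, WittVector.teichmuller_coeff_zero]
    rw [h1]
    exact neg_ne_zero.2 one_ne_zero
  have hζ1 := valuation_root_eq_one (v := v) hζ
  have hsmall : v ((ζ - 1) * ∑ z, teich j z⁻¹ * b z) < 1 := by
    rw [map_mul]
    refine mul_lt_one_of_lt_of_le (hv.sub_one_lt_one hζ) (valuation_sum_le_one _ _ fun z _ => ?_)
    rw [map_mul]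
    refine mul_le_one' (hv.teich_le_one _) (valuation_sum_le_one _ _ fun i _ =>
      valuation_sum_le_one _ _ fun l _ => ?_)
    rw [map_pow, hζ1, one_pow]
  rw [hsum, map_mul, Valuation.map_add_eq_of_lt_left _ (by rwa [hunit]), hunit, mul_one]

/-- If p divides r, Frobenius invariance passes to r / p. Otherwise r = s + 1 without carry, and
G(s) G(1) = J G(s + 1) with J an integral Jacobi sum. -/
theorem IsWittValuation.pow_digitSum_le_gaussSum (hv : IsWittValuation v j)
    (hζ : IsPrimitiveRoot ζ p) (r : ℕ) (hr : 0 < r) (hr' : r < Fintype.card F - 1) :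
    v (ζ - 1) ^ digitSum p r ≤ v (gaussSum ((teich j)⁻¹ ^ r) (traceChar F hζ)) := by
  have hp : p.Prime := Fact.out
  induction r using Nat.strong_induction_on with
  | _ r ih =>
  by_cases hdvd : p ∣ r
  · obtain ⟨s, rfl⟩ := hdvd
    have hs : 0 < s := Nat.pos_of_mul_pos_left hr
    have hlt : s < p * s := by nlinarith [hp.one_lt]
    rw [gaussSum_inv_teich_pow_char_mul hζ hs]
    have := digitSum_mul_add hp.one_lt s hp.pos
    rw [add_zero, add_zero] at this
    rw [this]
    exact ih s hlt hs (by omega)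
  obtain ⟨s, rfl⟩ : ∃ s, r = s + 1 := ⟨r - 1, by omega⟩
  have hdig : digitSum p (s + 1) = digitSum p s + 1 := by
    have h1 := Nat.div_add_mod s p
    have h2 := Nat.mod_lt s hp.pos
    have h3 : s % p + 1 < p := by
      refine lt_of_le_of_ne h2 fun h => hdvd ⟨s / p + 1, ?_⟩
      rw [mul_add]
      omega
    conv_lhs => rw [← h1, add_assoc]
    rw [digitSum_mul_add hp.one_lt _ h3, digitSum_eq_mod_add hp.one_lt s, add_assoc]
  rcases Nat.eq_zero_or_pos s with rfl | hs
  · rw [hdig, digitSum_zero, zero_add, pow_one, pow_one,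
      hv.gaussSum_inv_teich hζ (by omega)]
  · have hne : (teich j)⁻¹ ^ s * (teich j)⁻¹ ≠ 1 := by
      rw [← pow_succ, Ne, hv.inv_teich_pow_eq_one_iff]
      exact fun h => absurd (Nat.le_of_dvd hr h) (by omega)
    have hJ := congrArg v (jacobiSum_mul_nontrivial hne (traceChar F hζ))
    rw [map_mul, map_mul, ← pow_succ, hv.gaussSum_inv_teich hζ (by omega)] at hJ
    have hJ1 : v (jacobiSum ((teich j)⁻¹ ^ s) (teich j)⁻¹) ≤ 1 := by
      refine valuation_sum_le_one _ _ fun z _ => ?_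
      rw [map_mul]
      refine mul_le_one' (hv.inv_teich_pow_le_one s z) ?_
      simpa using hv.inv_teich_pow_le_one 1 (1 - z)
    calc v (ζ - 1) ^ digitSum p (s + 1) = v (ζ - 1) ^ digitSum p s * v (ζ - 1) := by
          rw [hdig, pow_succ]
      _ ≤ v (gaussSum ((teich j)⁻¹ ^ s) (traceChar F hζ)) * v (ζ - 1) := by
          gcongr
          exact ih s (by omega) hs (by omega)
      _ ≤ _ := by
          rw [← hJ]
          exact mul_le_of_le_one_right' hJ1

/-- Stickelberger's theorem on the valuation of Gauss sums. -/
theorem IsWittValuation.valuation_gaussSum (hv : IsWittValuation v j)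
    (hζ : IsPrimitiveRoot ζ p) {n : ℕ} (hF : Fintype.card F = p ^ n) (r : ℕ) (hr : 0 < r)
    (hr' : r < Fintype.card F - 1) :
    v (gaussSum ((teich j)⁻¹ ^ r) (traceChar F hζ)) = v (ζ - 1) ^ digitSum p r := by
  have hp : p.Prime := Fact.out
  have hpos := valuation_sub_one_pos (v := v) hζ
  set s := Fintype.card F - 1 - r with hs
  have h1 := hv.pow_digitSum_le_gaussSum hζ r hr hr'
  have h2 := hv.pow_digitSum_le_gaussSum hζ s (by omega) (by omega)
  have hne : (teich j)⁻¹ ^ r ≠ 1 := by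
    rw [Ne, hv.inv_teich_pow_eq_one_iff]
    exact fun h => absurd (Nat.le_of_dvd hr h) (by omega)
  have hinv : ((teich j)⁻¹ ^ r)⁻¹ = (teich j)⁻¹ ^ s := by
    rw [inv_eq_iff_mul_eq_one, ← pow_add, hv.inv_teich_pow_eq_one_iff]
    exact ⟨1, by omega⟩
  have hG := congrArg v (gaussSum_mul_gaussSum_eq_card hne (traceChar_isPrimitive hζ))
  have hneg : v (gaussSum ((teich j)⁻¹ ^ s) (traceChar F hζ)⁻¹) =
      v (gaussSum ((teich j)⁻¹ ^ s) (traceChar F hζ)) := by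
    have hsq : (((teich j)⁻¹ ^ s) (-1)) ^ 2 = 1 := by rw [← map_pow, neg_one_sq, map_one]
    conv_rhs => rw [← mul_gaussSum_inv_eq_gaussSum, map_mul,
      valuation_eq_one_of_pow_eq_one two_ne_zero hsq, one_mul]
  -- The bounds for r and its complement s multiply to v(#F), which is also the size of the product
  -- of the two Gauss sums; so neither bound can be strict.
  have hcard : v (Fintype.card F : L) = v (ζ - 1) ^ digitSum p r * v (ζ - 1) ^ digitSum p s := by
    rw [← pow_add, hs, hF, digitSum_compl hp.one_lt n r (by omega), Nat.cast_pow, map_pow,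
      valuation_natCast_eq_pow hζ, ← pow_mul, mul_comm]
  rw [map_mul, hinv, hneg, hcard] at hG
  refine le_antisymm ?_ h1
  by_contra hlt
  rw [not_le] at hlt
  have hspos : 0 < v (ζ - 1) ^ digitSum p s := pow_pos hpos _
  exact (mul_lt_mul hlt h2 hspos zero_le).ne hG.symm

end Stickelberger

/-! ### Expansion of functions on F in Teichmüller powers -/

section Expansion

variable {p : ℕ} [Fact p.Prime] {F : Type*} [Field F] [Fintype F]
  {L : Type*} [Field L] {Γ₀ : Type*} [LinearOrderedCommGroupWithZero Γ₀] {v : Valuation L Γ₀}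
  {j : WittVector p F →+* L} {ζ : L}

open Classical in
/-- The functions on `F` dual to the powers `teich j ^ r`, `0 ≤ r ≤ #F - 1`. -/
noncomputable def teichDual (j : WittVector p F →+* L) (r : ℕ) (z : F) : L :=
  -- The powers 0 and #F - 1 agree away from 0 and differ at 0; the corrections at z = 0 separate
  -- them.
  if r = 0 then (if z = 0 then 1 else 0) else
    ((Fintype.card F - 1 : ℕ) : L)⁻¹ * ((teich j)⁻¹ ^ r) z -
      if r = Fintype.card F - 1 ∧ z = 0 then 1 else 0

variable [CharP F p]

theorem IsWittValuation.teichDual_le_one (hv : IsWittValuation v j) (r : ℕ) (z : F) :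
    v (teichDual j r z) ≤ 1 := by
  unfold teichDual
  split_ifs
  · simp
  · simp
  all_goals
    refine (v.map_sub _ _).trans (max_le ?_ (by simp))
    rw [map_mul, map_inv₀, hv.card_sub_one_eq_one, inv_one, one_mul]
    exact hv.inv_teich_pow_le_one r z

theorem IsWittValuation.sum_teichDual_mul_teich_pow (hv : IsWittValuation v j) {r s : ℕ}
    (hr : r < Fintype.card F) (hs : s < Fintype.card F) :
    ∑ z, teichDual j r z * teich j z ^ s = if r = s then 1 else 0 := by
  classical
  have hcard : 1 < Fintype.card F := Fintype.one_lt_card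
  rcases Nat.eq_zero_or_pos r with rfl | hr0
  · have h1 : ∀ z, teichDual j 0 z * teich j z ^ s = if z = 0 then (0 : L) ^ s else 0 := by
      intro z
      by_cases hz : z = 0 <;> simp [teichDual, hz, MulChar.map_zero]
    rw [sum_congr rfl fun z _ => h1 z, sum_ite_eq' univ (0 : F), if_pos (mem_univ _)]
    by_cases hs0 : s = 0
    · simp [hs0]
    · rw [zero_pow hs0, if_neg (Ne.symm hs0)]
  have hQ : ((Fintype.card F - 1 : ℕ) : L) ≠ 0 := by
    rw [← Valuation.ne_zero_iff v, hv.card_sub_one_eq_one]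
    exact one_ne_zero
  have hchar : ∑ z, ((teich j)⁻¹ ^ r) z * teich j z ^ s =
      if s ≡ r [MOD Fintype.card F - 1] then ((Fintype.card F - 1 : ℕ) : L) else 0 := by
    have h1 : ∀ z, ((teich j)⁻¹ ^ r) z * teich j z ^ s = ((teich j)⁻¹ ^ r * teich j ^ s) z := by
      intro z
      by_cases hz : z = 0
      · simp only [hz, MulChar.map_zero, zero_mul]
      · rw [MulChar.mul_apply]
        congr 1
        exact (MulChar.pow_apply_coe _ s (Units.mk0 z hz)).symm
    rw [sum_congr rfl fun z _ => h1 z]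
    split_ifs with h
    · rw [hv.teich_pow_eq_pow_iff.2 h, ← mul_pow, inv_mul_cancel, one_pow,
        MulChar.sum_one_eq_card_sub_one]
    · refine MulChar.sum_eq_zero_of_ne_one fun h2 => h ?_
      rw [inv_pow, inv_mul_eq_one] at h2
      exact hv.teich_pow_eq_pow_iff.1 h2.symm
  have h2 : ∀ z, teichDual j r z * teich j z ^ s =
      ((Fintype.card F - 1 : ℕ) : L)⁻¹ * (((teich j)⁻¹ ^ r) z * teich j z ^ s) -
        if z = 0 then (if r = Fintype.card F - 1 then (0 : L) ^ s else 0) else 0 := by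
    intro z
    rw [teichDual, if_neg hr0.ne']
    by_cases hz : z = 0
    · by_cases hrq : r = Fintype.card F - 1 <;>
        simp [hz, hrq, MulChar.map_zero]
    · simp [hz, mul_assoc]
  rw [sum_congr rfl fun z _ => h2 z, sum_sub_distrib, ← mul_sum, hchar,
    sum_ite_eq' univ (0 : F), if_pos (mem_univ _)]
  by_cases hrs : r = s
  · have : s ≠ 0 := by omega
    simp [hrs, this, inv_mul_cancel₀ hQ, Nat.ModEq.refl]
  by_cases hs0 : s = 0
  · subst hs0
    by_cases hrq : r = Fintype.card F - 1
    · rw [if_pos (by rw [hrq]; simp [Nat.ModEq]), if_pos hrq, if_neg hrs, inv_mul_cancel₀ hQ,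
        pow_zero, sub_self]
    · rw [if_neg, if_neg hrq, if_neg hrs, mul_zero, sub_self]
      intro h
      have := Nat.le_of_dvd hr0 ((Nat.modEq_zero_iff_dvd).1 h.symm)
      omega
  · rw [if_neg, zero_pow hs0, ite_self, if_neg hrs, mul_zero, sub_self]
    intro h
    have h3 := fun hlt => h.add_le_of_lt hlt
    have h4 := fun hlt => h.symm.add_le_of_lt hlt
    omega

/-- Every function on `F` is a combination of the powers `teich j ^ r`, `0 ≤ r ≤ #F - 1`. -/
theorem IsWittValuation.eq_sum_teich_pow (hv : IsWittValuation v j) (f : F → L) (z : F) :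
    f z = ∑ r : Fin (Fintype.card F), (∑ y, teichDual j r y * f y) * teich j z ^ (r : ℕ) := by
  classical
  let A : Matrix (Fin (Fintype.card F)) F L := fun r y => teichDual j r y
  let B : Matrix F (Fin (Fintype.card F)) L := fun y r => teich j y ^ (r : ℕ)
  have hAB : A * B = 1 := by
    ext r s
    rw [Matrix.mul_apply, Matrix.one_apply]
    simp only [A, B]
    rw [hv.sum_teichDual_mul_teich_pow r.2 s.2]
    simp [Fin.ext_iff]
  -- The two index sets have equal size, so the duality relation is also the inversion formula.
  have hBA := (Matrix.mul_eq_one_comm_of_card_eq (Fin (Fintype.card F)) F L (by simp)).1 hAB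
  have h1 : ∀ y, ∑ r, B z r * A r y = if z = y then 1 else 0 := by
    intro y
    rw [← Matrix.mul_apply, hBA, Matrix.one_apply]
  calc f z = ∑ y, (∑ r, B z r * A r y) * f y := by simp [h1]
    _ = _ := by
      simp_rw [sum_mul]
      rw [sum_comm]
      refine sum_congr rfl fun r _ => sum_congr rfl fun y _ => ?_
      simp only [A, B]
      ring

variable [Algebra (ZMod p) F]

/-- The coefficients of the additive character in the basis of powers of `teich j`. -/
noncomputable def traceCoeff (j : WittVector p F →+* L) (hζ : IsPrimitiveRoot ζ p) (r : ℕ) : L :=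
  ∑ y, teichDual j r y * traceChar F hζ y

theorem IsWittValuation.valuation_traceCoeff (hv : IsWittValuation v j)
    (hζ : IsPrimitiveRoot ζ p) {n : ℕ} (hF : Fintype.card F = p ^ n) {r : ℕ}
    (hr : r < Fintype.card F) :
    v (traceCoeff j hζ r) = v (ζ - 1) ^ digitSum p r := by
  classical
  have hp : p.Prime := Fact.out
  have hcard : 1 < Fintype.card F := Fintype.one_lt_card
  have hQ := hv.card_sub_one_eq_one
  have hQ0 : ((Fintype.card F - 1 : ℕ) : L) ≠ 0 := by
    rw [← Valuation.ne_zero_iff v, hQ]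
    exact one_ne_zero
  unfold traceCoeff
  rcases Nat.eq_zero_or_pos r with rfl | hr0
  · simp [teichDual, digitSum_zero]
  have h1 : ∑ y, teichDual j r y * traceChar F hζ y =
      ((Fintype.card F - 1 : ℕ) : L)⁻¹ * gaussSum ((teich j)⁻¹ ^ r) (traceChar F hζ) -
        if r = Fintype.card F - 1 then 1 else 0 := by
    have h2 : ∀ y, teichDual j r y * traceChar F hζ y =
        ((Fintype.card F - 1 : ℕ) : L)⁻¹ * (((teich j)⁻¹ ^ r) y * traceChar F hζ y) -
          if y = 0 then (if r = Fintype.card F - 1 then 1 else 0) else 0 := by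
      intro y
      rw [teichDual, if_neg hr0.ne']
      by_cases hy : y = 0
      · by_cases hrq : r = Fintype.card F - 1 <;> simp [hy, hrq]
      · simp [hy, mul_assoc]
    rw [sum_congr rfl fun y _ => h2 y, sum_sub_distrib, ← mul_sum, sum_ite_eq' univ (0 : F),
      if_pos (mem_univ _), gaussSum]
  rw [h1]
  by_cases hrq : r = Fintype.card F - 1
  · rw [if_pos hrq, hv.inv_teich_pow_eq_one_iff.2 (by rw [hrq]),
      gaussSum_one_left (traceChar_ne_one hζ)]
    -- For r = #F - 1 the Gauss sum is -1, and the correction at 0 produces -#F / (#F - 1), again of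
    -- size v(π)^(S_p(r)).
    have h3 : ((Fintype.card F - 1 : ℕ) : L)⁻¹ * -1 - 1 =
        -(((Fintype.card F - 1 : ℕ) : L)⁻¹ * (Fintype.card F : L)) := by
      have h4 : (Fintype.card F : L) = ((Fintype.card F - 1 : ℕ) : L) + 1 := by
        rw [← Nat.cast_add_one, Nat.sub_add_cancel hcard.le]
      rw [h4]
      field_simp
      ring
    rw [h3, Valuation.map_neg, map_mul, map_inv₀, hQ, inv_one, one_mul, hrq, hF,
      digitSum_pow_sub_one hp.one_lt, Nat.cast_pow, map_pow, valuation_natCast_eq_pow hζ,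
      ← pow_mul, mul_comm]
  · rw [if_neg hrq, sub_zero, map_mul, map_inv₀, hQ, inv_one, one_mul,
      hv.valuation_gaussSum hζ hF r hr0 (by omega)]

end Expansion

/-! ### The character sum formula for the number of solutions -/

section Counting

variable {p : ℕ} [Fact p.Prime] {F : Type*} [Field F] [Fintype F]
  {L : Type*} [Field L] {Γ₀ : Type*} [LinearOrderedCommGroupWithZero Γ₀] {v : Valuation L Γ₀}
  {j : WittVector p F →+* L} {ζ : L}

open Classical in
/-- The power sums of the Teichmüller representatives of the fixed points of `z ↦ z ^ q`. -/
noncomputable def fixedPowerSum (j : WittVector p F →+* L) (q u : ℕ) : L :=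
  ∑ a : F with a ^ q = a, teich j a ^ u

theorem IsWittValuation.fixedPowerSum_le_one (hv : IsWittValuation v j) (q u : ℕ) :
    v (fixedPowerSum j q u) ≤ 1 := by
  refine valuation_sum_le_one _ _ fun a _ => ?_
  rw [map_pow]
  exact pow_le_one₀ zero_le (hv.teich_le_one _)

open Classical in
theorem fixedPowerSum_eq_sum_ker {q u : ℕ} (hq : 0 < q) (hu : 0 < u) :
    fixedPowerSum j q u =
      ∑ h : (powMonoidHom (q - 1) : Fˣ →* Fˣ).ker, teich j (h : Fˣ) ^ u := by
  symm
  refine sum_of_injOn (fun h => ((h : Fˣ) : F)) ?_ ?_ ?_ fun _ _ => rfl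
  · intro a _ b _ hab
    exact Subtype.ext (Units.ext hab)
  · intro a _
    have ha : (a : Fˣ) ^ (q - 1) = 1 := a.2
    rw [mem_coe, mem_filter]
    refine ⟨mem_univ _, ?_⟩
    rw [← Units.val_pow_eq_pow_val, ← pow_sub_one_mul hq.ne', ha, one_mul]
  · intro a ha hna
    have ha' : a ^ q = a := (mem_filter.1 ha).2
    by_cases h0 : a = 0
    · rw [h0, MulChar.map_zero, zero_pow hu.ne']
    · have h1 : a ^ (q - 1) * a = 1 * a := by rw [pow_sub_one_mul hq.ne', ha', one_mul]
      have hmem : Units.mk0 a h0 ∈ (powMonoidHom (q - 1) : Fˣ →* Fˣ).ker := by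
        rw [MonoidHom.mem_ker, powMonoidHom_apply, Units.ext_iff, Units.val_pow_eq_pow_val]
        exact mul_right_cancel₀ h0 h1
      exact absurd ⟨⟨Units.mk0 a h0, hmem⟩, mem_coe.2 (mem_univ _), rfl⟩ hna

variable [CharP F p]

theorem IsWittValuation.fixedPowerSum_eq_zero (hv : IsWittValuation v j) {q m u : ℕ} (hq : 1 < q)
    (hF : Fintype.card F = q ^ m) (hu : ¬ q - 1 ∣ u) : fixedPowerSum j q u = 0 := by
  classical
  have hu0 : 0 < u := Nat.pos_of_ne_zero fun h => hu (by simp [h])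
  rw [fixedPowerSum_eq_sum_ker (by omega) hu0]
  let φ : (powMonoidHom (q - 1) : Fˣ →* Fˣ).ker →* L :=
    { toFun := fun h => teich j (h : Fˣ) ^ u
      map_one' := by simp
      map_mul' := by simp [mul_pow] }
  refine sum_hom_units_eq_zero φ fun hφ => hu ?_
  obtain ⟨g, hg⟩ := IsCyclic.exists_generator (α := Fˣ)
  have ho : orderOf g = Fintype.card F - 1 := by
    rw [orderOf_eq_card_of_forall_mem_zpowers hg, Nat.card_eq_fintype_card, Fintype.card_units]
  obtain ⟨c, hc⟩ : q - 1 ∣ Fintype.card F - 1 := by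
    rw [hF]
    simpa using Nat.sub_dvd_pow_sub_pow q 1 m
  have hcpos : 0 < c := by
    refine Nat.pos_of_ne_zero fun h => ?_
    have : 1 < Fintype.card F := Fintype.one_lt_card
    rw [h, mul_zero] at hc
    omega
  have hmem : g ^ c ∈ (powMonoidHom (q - 1) : Fˣ →* Fˣ).ker := by
    rw [MonoidHom.mem_ker, powMonoidHom_apply, ← pow_mul, mul_comm, ← hc, ← ho, pow_orderOf_eq_one]
  have h1 : teich j ((g ^ c : Fˣ) : F) ^ u = 1 := DFunLike.congr_fun hφ ⟨g ^ c, hmem⟩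
  rw [← map_pow, ← map_one (teich j), hv.teich_injective.eq_iff, ← Units.val_pow_eq_pow_val,
    Units.val_eq_one, ← pow_mul] at h1
  have h2 := orderOf_dvd_of_pow_eq_one h1
  rw [ho, hc, mul_comm] at h2
  exact Nat.dvd_of_mul_dvd_mul_left hcpos h2

/-- The sum counts the (q - 1)-th roots of unity in F, a divisor of #F - 1 and hence prime to p. -/
theorem IsWittValuation.fixedPowerSum_eq_one (hv : IsWittValuation v j) {q u : ℕ}
    (hq : 1 < q) (hu0 : 0 < u) (hu : q - 1 ∣ u) : v (fixedPowerSum j q u) = 1 := by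
  classical
  have h1 : fixedPowerSum j q u =
      ((Nat.card (powMonoidHom (q - 1) : Fˣ →* Fˣ).ker : ℕ) : L) := by
    rw [fixedPowerSum_eq_sum_ker (by omega) hu0, sum_congr rfl (g := fun _ => (1 : L))]
    · simp
    · intro h _
      obtain ⟨c, rfl⟩ := hu
      have hh : (h : Fˣ) ^ (q - 1) = 1 := h.2
      rw [← map_pow, ← Units.val_pow_eq_pow_val, pow_mul, hh, one_pow, Units.val_one, map_one]
  rw [h1]
  have h2 : Nat.card (powMonoidHom (q - 1) : Fˣ →* Fˣ).ker ∣ Fintype.card F - 1 := by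
    rw [← Fintype.card_units, ← Nat.card_eq_fintype_card]
    exact Subgroup.card_subgroup_dvd_card _
  refine hv.natCast_eq_one fun h => ?_
  obtain ⟨c, hc⟩ := h.trans h2
  have h3 := hv.card_sub_one_eq_one
  rw [hc, Nat.cast_mul, map_mul] at h3
  exact (mul_lt_one_of_lt_of_le hv.natCast_lt_one (hv.natCast_le_one c)).ne h3

theorem AddChar.map_sum_eq_prod {A M ι : Type*} [AddCommGroup A] [CommMonoid M] (ψ : AddChar A M)
    (s : Finset ι) (f : ι → A) : ψ (∑ i ∈ s, f i) = ∏ i ∈ s, ψ (f i) := by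
  classical
  induction s using Finset.induction_on with
  | empty => simp
  | insert a s ha ih => rw [sum_insert ha, prod_insert ha, AddChar.map_add_eq_mul, ih]

theorem Fintype.prod_sum_eq_sum_prod {ι κ R : Type*} [Fintype ι] [DecidableEq ι] [Fintype κ] [CommSemiring R]
    (g : ι → κ → R) : ∏ i, ∑ x, g i x = ∑ f : ι → κ, ∏ i, g i (f i) := by
  rw [prod_univ_sum, Fintype.piFinset_univ]

variable [Algebra (ZMod p) F]

open Classical in
/-- The number of solutions as a sum of values of the additive character. -/
theorem numSolutions_eq_sum (hζ : IsPrimitiveRoot ζ p) (hp0 : (p : L) ≠ 0) {n e q k : ℕ}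
    (hF : Fintype.card F = p ^ n) (hq : q = p ^ e) (f : MvPolynomial (Fin k) F) :
    (numSolutions q f : L) = ∑ a : F with a ^ q = a,
      ∑ x : Fin k → F, traceChar F hζ (a * MvPolynomial.eval x f) := by
  set ψ := traceChar F hζ with hψ
  have hprim : ψ.IsPrimitive := traceChar_isPrimitive hζ
  have hQ : (Fintype.card F : L) ≠ 0 := by
    rw [hF, Nat.cast_pow]
    exact pow_ne_zero _ hp0
  have hinner : ∀ a : F, ∑ y : F, ψ (a * (y - y ^ q)) =
      if a ^ q = a then (Fintype.card F : L) else 0 := by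
    intro a
    -- By Frobenius invariance ψ(a y) = ψ(a^q y^q), so the sum over y detects a^q = a.
    have h1 : ∀ y : F, ψ (a * (y - y ^ q)) = ψ (iterateFrobeniusEquiv F p e y * (a ^ q - a)) := by
      intro y
      rw [iterateFrobeniusEquiv_apply, iterateFrobenius_def, ← hq, mul_sub, mul_sub,
        AddChar.map_sub_eq_div, AddChar.map_sub_eq_div, mul_comm (y ^ q) a, ← mul_pow, hq,
        mul_comm y a, traceChar_pow_char_pow]
    rw [sum_congr rfl fun y _ => h1 y]
    refine (Fintype.sum_equiv (iterateFrobeniusEquiv F p e).toEquiv _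
      (fun y => ψ (y * (a ^ q - a))) fun _ => rfl).trans ?_
    rw [AddChar.sum_mulShift _ hprim, sub_eq_zero]
    split_ifs <;> simp
  have hcount : (numSolutions q f : L) =
      ∑ x : Fin k → F, ∑ y : F, if MvPolynomial.eval x f - (y ^ q - y) = 0 then 1 else 0 := by
    rw [numSolutions, Nat.card_eq_fintype_card, Fintype.card_subtype, card_filter, Nat.cast_sum,
      Fintype.sum_prod_type]
    simp [sub_eq_zero]
  refine mul_left_cancel₀ hQ ?_
  have horth : ∀ u : F, (Fintype.card F : L) * (if u = 0 then 1 else 0) = ∑ a : F, ψ (a * u) := by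
    intro u
    rw [AddChar.sum_mulShift _ hprim]
    split_ifs <;> simp
  calc (Fintype.card F : L) * numSolutions q f
      = ∑ x : Fin k → F, ∑ y : F, ∑ a : F, ψ (a * (MvPolynomial.eval x f - (y ^ q - y))) := by
        rw [hcount]
        simp_rw [mul_sum, horth]
    _ = ∑ a : F, ∑ x : Fin k → F, ψ (a * MvPolynomial.eval x f) *
          ∑ y : F, ψ (a * (y - y ^ q)) := by
        simp_rw [mul_sum]
        rw [sum_congr rfl fun x _ => sum_comm, sum_comm]
        refine sum_congr rfl fun a _ => sum_congr rfl fun x _ => sum_congr rfl fun y _ => ?_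
        rw [← AddChar.map_add_eq_mul]
        congr 1
        ring
    _ = _ := by
        simp_rw [hinner]
        rw [sum_filter, mul_sum]
        refine sum_congr rfl fun a _ => ?_
        split_ifs
        · rw [← sum_mul, mul_comm]
        · simp

/-- The coefficient belonging to the exponents `r` in the expansion of the number of solutions. -/
noncomputable def expansionCoeff {k : ℕ} {ι : Type*} [Fintype ι] (j : WittVector p F →+* L)
    (hζ : IsPrimitiveRoot ζ p) (q : ℕ) (t : ι → Fin k → ℕ) (r : ι → ℕ) : L :=
  (∏ s, traceCoeff j hζ (r s)) * fixedPowerSum j q (∑ s, r s) *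
    ∏ i, ∑ z, teich j z ^ (∑ s, r s * t s i)

theorem IsWittValuation.numSolutions_eq_sum_expansionCoeff (hv : IsWittValuation v j)
    (hζ : IsPrimitiveRoot ζ p) {n e q k : ℕ}
    (hF : Fintype.card F = p ^ n) (hq : q = p ^ e) (f : MvPolynomial (Fin k) F) {ι : Type*}
    [Fintype ι] [DecidableEq ι] (c : ι → F) (t : ι → Fin k → ℕ)
    (hf : ∀ x, MvPolynomial.eval x f = ∑ s, c s * ∏ i, x i ^ t s i) :
    (numSolutions q f : L) = ∑ r : ι → Fin (Fintype.card F),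
      expansionCoeff j hζ q t (fun s => r s) * ∏ s, teich j (c s) ^ (r s : ℕ) := by
  classical
  rw [numSolutions_eq_sum hζ hv.natCast_ne_zero hF hq]
  have hψ : ∀ (a : F) (x : Fin k → F), traceChar F hζ (a * MvPolynomial.eval x f) =
      ∑ r : ι → Fin (Fintype.card F), (∏ s, traceCoeff j hζ (r s)) *
        (∏ s, teich j (c s) ^ (r s : ℕ)) * teich j a ^ (∑ s, (r s : ℕ)) *
        ∏ i, teich j (x i) ^ (∑ s, (r s : ℕ) * t s i) := by
    intro a x
    have h1 : traceChar F hζ (a * MvPolynomial.eval x f) =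
        ∏ s, traceChar F hζ (a * (c s * ∏ i, x i ^ t s i)) := by
      rw [hf, mul_sum]
      exact AddChar.map_sum_eq_prod _ _ _
    rw [h1, prod_congr rfl fun s _ => hv.eq_sum_teich_pow (traceChar F hζ) _,
      Fintype.prod_sum_eq_sum_prod]
    refine sum_congr rfl fun r _ => ?_
    rw [← prod_pow_eq_pow_sum]
    simp_rw [← prod_pow_eq_pow_sum]
    rw [prod_comm, ← prod_mul_distrib, ← prod_mul_distrib, ← prod_mul_distrib]
    refine prod_congr rfl fun s _ => ?_
    rw [traceCoeff, map_mul, map_mul, map_prod, mul_pow, mul_pow, ← prod_pow]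
    simp_rw [map_pow, ← pow_mul, mul_comm (t s _)]
    ring
  simp_rw [hψ]
  rw [sum_congr rfl fun a _ => sum_comm, sum_comm]
  refine sum_congr rfl fun r _ => ?_
  rw [expansionCoeff, fixedPowerSum, Fintype.prod_sum_eq_sum_prod]
  simp_rw [← mul_sum, ← sum_mul]
  rw [← mul_sum]
  ring

end Counting

/-! ### Polynomials with prescribed coefficients -/

section PolyOfCoeffs

variable {F : Type*} [Field F] {k : ℕ} {D : Finset ℕ}

/-- The polynomial with exponents in `exponentSet` and given coefficients. -/
noncomputable def polyOfCoeffs (Q k : ℕ) (D : Finset ℕ) (c : exponentSet Q k D → F) :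
    MvPolynomial (Fin k) F :=
  ∑ s, MvPolynomial.monomial (Finsupp.equivFunOnFinite.symm s.1) (c s)

theorem eval_polyOfCoeffs {Q : ℕ} (c : exponentSet Q k D → F) (x : Fin k → F) :
    MvPolynomial.eval x (polyOfCoeffs Q k D c) = ∑ s, c s * ∏ i, x i ^ s.1 i := by
  rw [polyOfCoeffs, map_sum]
  refine sum_congr rfl fun s _ => ?_
  rw [MvPolynomial.eval_monomial, Finsupp.prod_fintype _ _ fun _ => pow_zero _]
  rfl

theorem degreeSet_polyOfCoeffs {Q : ℕ} (c : exponentSet Q k D → F) :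
    degreeSet (polyOfCoeffs Q k D c) ⊆ ↑D := by
  intro d hd
  by_contra hdD
  refine hd ?_
  rw [polyOfCoeffs, map_sum]
  refine sum_eq_zero fun s _ => ?_
  ext n
  rw [MvPolynomial.coeff_homogeneousComponent, MvPolynomial.coeff_monomial, MvPolynomial.coeff_zero]
  split_ifs with h1 h2
  · refine absurd ?_ hdD
    rw [← h1, ← h2, Finsupp.degree_eq_sum]
    exact (mem_filter.1 s.2).2
  · rfl
  · rfl

end PolyOfCoeffs

/-! ### The lower bound and its sharpness -/

section Bounds

variable {p : ℕ} [Fact p.Prime] {F : Type*} [Field F] [CharP F p]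
  {L : Type*} [Field L] {Γ₀ : Type*} [LinearOrderedCommGroupWithZero Γ₀] {v : Valuation L Γ₀}
  {j : WittVector p F →+* L} {ζ : L}

theorem IsWittValuation.valuation_natCast (hv : IsWittValuation v j) (hζ : IsPrimitiveRoot ζ p)
    {N : ℕ} (hN : N ≠ 0) : v (N : L) = v (ζ - 1) ^ ((p - 1) * padicValNat p N) := by
  obtain ⟨c, hc, h⟩ : ∃ c, ¬ p ∣ c ∧ N = p ^ padicValNat p N * c := by
    obtain ⟨c, hc⟩ := pow_padicValNat_dvd (p := p) (n := N)
    refine ⟨c, fun hd => ?_, hc⟩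
    refine pow_succ_padicValNat_not_dvd (p := p) hN ?_
    conv_rhs => rw [hc]
    rw [pow_succ]
    exact mul_dvd_mul_left _ hd
  conv_lhs => rw [h]
  rw [Nat.cast_mul, Nat.cast_pow, map_mul, map_pow, hv.natCast_eq_one hc, mul_one,
    valuation_natCast_eq_pow hζ, pow_mul]

theorem IsWittValuation.le_valP (hv : IsWittValuation v j) (hζ : IsPrimitiveRoot ζ p) {N M : ℕ}
    (h : v (N : L) ≤ v (ζ - 1) ^ M) :
    ((1 / ((p : ℚ) - 1) * M : ℚ) : WithTop ℚ) ≤ valP p N := by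
  unfold valP
  split_ifs with hN
  · exact le_top
  rw [hv.valuation_natCast hζ hN,
    pow_le_pow_iff_right_of_lt_one₀ (valuation_sub_one_pos hζ) (hv.sub_one_lt_one hζ)] at h
  have hp : p.Prime := Fact.out
  have hp1 : (0 : ℚ) < p - 1 := by
    have : (1 : ℚ) < p := by exact_mod_cast hp.one_lt
    linarith
  rw [WithTop.coe_le_coe, one_div, inv_mul_le_iff₀ hp1]
  have h' : (M : ℚ) ≤ ((p - 1 : ℕ) : ℚ) * (padicValNat p N : ℚ) := by exact_mod_cast h
  rwa [Nat.cast_sub hp.one_le, Nat.cast_one] at h'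

theorem IsWittValuation.valP_eq (hv : IsWittValuation v j) (hζ : IsPrimitiveRoot ζ p) {N M : ℕ}
    (h : v (N : L) = v (ζ - 1) ^ M) :
    valP p N = ((1 / ((p : ℚ) - 1) * M : ℚ) : WithTop ℚ) := by
  have hN : N ≠ 0 := by
    rintro rfl
    rw [Nat.cast_zero, map_zero] at h
    exact (pow_pos (valuation_sub_one_pos (v := v) hζ) M).ne h
  rw [valP, if_neg hN]
  rw [hv.valuation_natCast hζ hN] at h
  have h2 := pow_right_injective₀ (valuation_sub_one_pos hζ) (hv.sub_one_lt_one hζ).ne h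
  have hp : p.Prime := Fact.out
  have hp1 : ((p : ℚ) - 1) ≠ 0 := by
    have : (1 : ℚ) < p := by exact_mod_cast hp.one_lt
    linarith
  rw [← h2, Nat.cast_mul, Nat.cast_sub hp.one_le, Nat.cast_one, one_div, inv_mul_cancel_left₀ hp1]

variable [Fintype F]

theorem IsWittValuation.valuation_sum_teich_pow (hv : IsWittValuation v j)
    (hζ : IsPrimitiveRoot ζ p) {n : ℕ} (hF : Fintype.card F = p ^ n) {u : ℕ}
    (hu : Fintype.card F - 1 ∣ u) :
    v (∑ z, teich j z ^ u) = v (ζ - 1) ^ (if u = 0 then n * (p - 1) else 0) := by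
  rw [hv.sum_teich_pow, if_pos hu]
  split_ifs with h0
  · rw [hF, Nat.cast_pow, map_pow, valuation_natCast_eq_pow hζ, ← pow_mul, mul_comm]
  · rw [hv.card_sub_one_eq_one, pow_zero]

variable [Algebra (ZMod p) F] {e q m k : ℕ} {D : Finset ℕ}

theorem IsWittValuation.valuation_expansionCoeff_le (hv : IsWittValuation v j)
    (hζ : IsPrimitiveRoot ζ p) (he : 0 < e) (hq : q = p ^ e) (hm : 0 < m)
    (hF : Fintype.card F = q ^ m) (hD : D ⊆ Icc 0 (k * (q ^ m - 1))) (hDpos : ∃ d ∈ D, 0 < d)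
    {M : ℕ} (hM : ∀ r, Feasible q m k D r → M ≤ ∑ x, digitSum p (r x)) {ι : Type*} [Fintype ι]
    (t : ι → Fin k → ℕ) (ht : ∀ s, ∑ i, t s i ∈ D) (r : ι → Fin (Fintype.card F)) :
    v (expansionCoeff j hζ q t fun s => r s) ≤ v (ζ - 1) ^ M := by
  have hp : p.Prime := Fact.out
  have hq1 : 1 < q := by rw [hq]; exact Nat.one_lt_pow he.ne' hp.one_lt
  have hF' : Fintype.card F = p ^ (e * m) := by rw [hF, hq, pow_mul]
  by_cases hA : q - 1 ∣ ∑ s, (r s : ℕ)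
  swap
  · rw [expansionCoeff, hv.fixedPowerSum_eq_zero hq1 hF hA, mul_zero, zero_mul, map_zero]
    exact zero_le
  by_cases hB : ∀ i, Fintype.card F - 1 ∣ ∑ s, (r s : ℕ) * t s i
  swap
  · push Not at hB
    obtain ⟨i, hi⟩ := hB
    have h0 : ∑ z, teich j z ^ (∑ s, (r s : ℕ) * t s i) = 0 := by
      rw [hv.sum_teich_pow, if_neg fun h => hi (by simp [h]), if_neg hi]
    rw [expansionCoeff, prod_eq_zero (mem_univ i) h0, mul_zero, map_zero]
    exact zero_le
  obtain ⟨r', hr', hle⟩ := exists_feasible hp he hq hm hD hDpos (fun s => (r s : ℕ)) t ht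
    (Nat.modEq_zero_iff_dvd.2 hA)
    fun i => Nat.modEq_zero_iff_dvd.2 (by rw [← hF]; exact hB i)
  have h1 : v (∏ s, traceCoeff j hζ (r s)) = v (ζ - 1) ^ ∑ s, digitSum p (r s) := by
    rw [map_prod, ← prod_pow_eq_pow_sum]
    exact prod_congr rfl fun s _ => hv.valuation_traceCoeff hζ hF' (r s).2
  have h2 : v (∏ i, ∑ z, teich j z ^ (∑ s, (r s : ℕ) * t s i)) =
      v (ζ - 1) ^ (#{i | ∑ s, (r s : ℕ) * t s i = 0} * (e * m * (p - 1))) := by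
    rw [map_prod, prod_congr rfl fun i _ => hv.valuation_sum_teich_pow hζ hF' (hB i),
      prod_pow_eq_pow_sum, ← sum_filter, sum_const, smul_eq_mul]
  rw [expansionCoeff, map_mul, map_mul, h1, h2]
  calc _ ≤ v (ζ - 1) ^ (∑ s, digitSum p (r s)) * 1 *
        v (ζ - 1) ^ (#{i | ∑ s, (r s : ℕ) * t s i = 0} * (e * m * (p - 1))) := by
        gcongr
        exact hv.fixedPowerSum_le_one _ _
    _ = v (ζ - 1) ^ (∑ s, digitSum p (r s) +
        #{i | ∑ s, (r s : ℕ) * t s i = 0} * (e * m * (p - 1))) := by rw [mul_one, pow_add]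
    _ ≤ v (ζ - 1) ^ M :=
        pow_le_pow_of_le_one zero_le (hv.sub_one_lt_one hζ).le ((hM r' hr').trans hle)

theorem IsWittValuation.valuation_numSolutions_le (hv : IsWittValuation v j)
    (hζ : IsPrimitiveRoot ζ p) (he : 0 < e) (hq : q = p ^ e) (hm : 0 < m)
    (hF : Fintype.card F = q ^ m) (hD : D ⊆ Icc 0 (k * (q ^ m - 1))) (hDpos : ∃ d ∈ D, 0 < d)
    {M : ℕ} (hM : ∀ r, Feasible q m k D r → M ≤ ∑ x, digitSum p (r x))
    (f : MvPolynomial (Fin k) F) (hf : degreeSet f ⊆ ↑D) :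
    v (numSolutions q f : L) ≤ v (ζ - 1) ^ M := by
  classical
  have hF' : Fintype.card F = p ^ (e * m) := by rw [hF, hq, pow_mul]
  have heval : ∀ x, MvPolynomial.eval x f =
      ∑ s : f.support, f.coeff s.1 * ∏ i, x i ^ (s.1 i) := by
    intro x
    rw [MvPolynomial.eval_eq', ← sum_coe_sort]
  -- The monomials of f are used as they stand, so exponents above Q - 1 may occur.
  rw [hv.numSolutions_eq_sum_expansionCoeff hζ hF' hq f _ (fun s : f.support => ⇑s.1) heval]
  refine v.map_sum_le fun r _ => ?_
  rw [map_mul]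
  refine (mul_le_of_le_one_right' ?_).trans
    (hv.valuation_expansionCoeff_le hζ he hq hm hF hD hDpos hM _ (fun s => ?_) r)
  · rw [map_prod]
    refine prod_le_one' fun s _ => ?_
    rw [map_pow]
    exact pow_le_one₀ zero_le (hv.teich_le_one _)
  · refine hf ?_
    intro h
    have h1 := congrArg (MvPolynomial.coeff s.1) h
    rw [MvPolynomial.coeff_homogeneousComponent, Finsupp.degree_eq_sum, if_pos rfl,
      MvPolynomial.coeff_zero] at h1
    exact MvPolynomial.mem_support_iff.1 s.2 h1

theorem IsWittValuation.exists_valuation_numSolutions_eq (hv : IsWittValuation v j)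
    (hζ : IsPrimitiveRoot ζ p) (he : 0 < e) (hq : q = p ^ e) (hm : 0 < m)
    (hF : Fintype.card F = q ^ m) (hD : D ⊆ Icc 0 (k * (q ^ m - 1))) (hDpos : ∃ d ∈ D, 0 < d)
    {r₀ : exponentSet (q ^ m) k D → ℕ} (hr₀ : Feasible q m k D r₀)
    (hM : ∀ r, Feasible q m k D r → ∑ x, digitSum p (r₀ x) ≤ ∑ x, digitSum p (r x)) :
    ∃ c : exponentSet (q ^ m) k D → F,
      v (numSolutions q (polyOfCoeffs (q ^ m) k D c) : L) =
        v (ζ - 1) ^ ∑ x, digitSum p (r₀ x) := by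
  classical
  have hp : p.Prime := Fact.out
  have hq1 : 1 < q := by rw [hq]; exact Nat.one_lt_pow he.ne' hp.one_lt
  have hF' : Fintype.card F = p ^ (e * m) := by rw [hF, hq, pow_mul]
  by_contra! hne
  have hlt : ∀ c, v (numSolutions q (polyOfCoeffs (q ^ m) k D c) : L) <
      v (ζ - 1) ^ ∑ x, digitSum p (r₀ x) := fun c =>
    lt_of_le_of_ne (hv.valuation_numSolutions_le hζ he hq hm hF hD hDpos hM _
      (degreeSet_polyOfCoeffs c)) (hne c)
  have hr₀lt : ∀ s, r₀ s < Fintype.card F := fun s => by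
    have := hr₀.le s
    have : 0 < q ^ m := by positivity
    omega
  let R : exponentSet (q ^ m) k D → Fin (Fintype.card F) := fun s => ⟨r₀ s, hr₀lt s⟩
  let t : exponentSet (q ^ m) k D → Fin k → ℕ := fun s => s.1
  have hN := fun c : exponentSet (q ^ m) k D → F => hv.numSolutions_eq_sum_expansionCoeff hζ hF' hq
    (polyOfCoeffs (q ^ m) k D c) c t (eval_polyOfCoeffs c)
  -- Pairing with the dual functions isolates the coefficient of r₀, so other terms of the expansion
  -- cannot cancel it.
  have hextract : ∑ c : exponentSet (q ^ m) k D → F, (∏ s, teichDual j (R s) (c s)) *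
      (numSolutions q (polyOfCoeffs (q ^ m) k D c) : L) =
        expansionCoeff j hζ q t fun s => R s := by
    simp_rw [hN, mul_sum]
    rw [sum_comm]
    have h1 : ∀ r : exponentSet (q ^ m) k D → Fin (Fintype.card F),
        ∑ c : exponentSet (q ^ m) k D → F, (∏ s, teichDual j (R s) (c s)) *
          (expansionCoeff j hζ q t (fun s => r s) * ∏ s, teich j (c s) ^ (r s : ℕ)) =
        if R = r then expansionCoeff j hζ q t (fun s => r s) else 0 := by
      intro r
      have h2 : ∏ s, ∑ z, teichDual j (R s) z * teich j z ^ (r s : ℕ) =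
          if R = r then 1 else 0 := by
        rw [prod_congr rfl fun s _ => hv.sum_teichDual_mul_teich_pow (R s).2 (r s).2]
        split_ifs with h
        · refine prod_eq_one fun s _ => ?_
          rw [h, if_pos rfl]
        · obtain ⟨s, hs⟩ := Function.ne_iff.1 h
          exact prod_eq_zero (mem_univ s) (if_neg fun h' => hs (Fin.ext h'))
      rw [Fintype.prod_sum_eq_sum_prod] at h2
      calc _ = expansionCoeff j hζ q t (fun s => r s) * ∑ c : exponentSet (q ^ m) k D → F,
            ∏ s, teichDual j (R s) (c s) * teich j (c s) ^ (r s : ℕ) := by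
            rw [mul_sum]
            refine sum_congr rfl fun c _ => ?_
            rw [prod_mul_distrib]
            ring
        _ = _ := by rw [h2, mul_ite, mul_one, mul_zero]
    rw [sum_congr rfl fun r _ => h1 r, sum_ite_eq, if_pos (mem_univ _)]
  have hcoeff : v (expansionCoeff j hζ q t fun s => R s) =
      v (ζ - 1) ^ ∑ x, digitSum p (r₀ x) := by
    have h1 : v (∏ s, traceCoeff j hζ (R s)) = v (ζ - 1) ^ ∑ s, digitSum p (r₀ s) := by
      rw [map_prod, ← prod_pow_eq_pow_sum]
      exact prod_congr rfl fun s _ => hv.valuation_traceCoeff hζ hF' (R s).2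
    have h2 : v (∏ i, ∑ z, teich j z ^ (∑ s, (R s : ℕ) * t s i)) = 1 := by
      rw [map_prod]
      refine prod_eq_one fun i _ => ?_
      have hdvd : Fintype.card F - 1 ∣ ∑ s, r₀ s * t s i := by
        rw [hF]
        exact hr₀.weighted_dvd i
      rw [hv.valuation_sum_teich_pow hζ hF' hdvd, if_neg (hr₀.weighted_pos i).ne', pow_zero]
    have h3 : v (fixedPowerSum j q (∑ s, (R s : ℕ))) = 1 := by
      refine hv.fixedPowerSum_eq_one hq1 ?_ (Nat.modEq_zero_iff_dvd.1 hr₀.sum_modEq)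
      obtain ⟨d, hdD, hd⟩ := hDpos
      -- A positive degree in D forces k > 0; a positive column sum then makes ∑ r₀ positive, as the
      -- unit power sum over a requires.
      have hk : 0 < k := by
        refine Nat.pos_of_ne_zero fun h => ?_
        have := (mem_Icc.1 (hD hdD)).2
        rw [h, zero_mul] at this
        omega
      obtain ⟨s, -, hs⟩ := exists_ne_zero_of_sum_ne_zero (hr₀.weighted_pos ⟨0, hk⟩).ne'
      exact sum_pos' (fun _ _ => Nat.zero_le _)
        ⟨s, mem_univ s, Nat.pos_of_ne_zero (left_ne_zero_of_mul hs)⟩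
    rw [expansionCoeff, map_mul, map_mul, h1, h2, h3, mul_one, mul_one]
  refine (v.map_sum_lt (pow_pos (valuation_sub_one_pos hζ) _).ne' fun c _ => ?_).ne
    ((congrArg v hextract).trans hcoeff)
  rw [map_mul]
  refine (mul_le_of_le_one_left' ?_).trans_lt (hlt c)
  rw [map_prod]
  exact prod_le_one' fun s _ => hv.teichDual_le_one _ _

end Bounds

/-! ### The main theorem -/

theorem mainTheorem3 (p e q m k : ℕ) (hp : p.Prime) (he : 0 < e) (hq : q = p ^ e) (hm : 0 < m)
    (F : Type*) [Field F] [Fintype F] (hF : Fintype.card F = q ^ m)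
    (D : Finset ℕ) (hD : D ⊆ Finset.Icc 0 (k * (q ^ m - 1)))
    (hDne : D.Nonempty) (hD0 : D ≠ {0}) :
    ∃ μ : ℚ,
      IsLeast {v : ℚ | ∃ r : exponentSet (q ^ m) k D → ℕ,
        Feasible q m k D r ∧ objective p (q ^ m) k D r = v} μ ∧
      (∀ f : MvPolynomial (Fin k) F, degreeSet f ⊆ ↑D →
        (μ : WithTop ℚ) ≤ valP p (numSolutions q f)) ∧
      ∃ f : MvPolynomial (Fin k) F, degreeSet f ⊆ ↑D ∧
        valP p (numSolutions q f) = (μ : WithTop ℚ) := by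
  have : Fact p.Prime := ⟨hp⟩
  have hDpos : ∃ d ∈ D, 0 < d := by
    by_contra! h
    refine hD0 (Finset.eq_singleton_iff_nonempty_unique_mem.2 ⟨hDne, fun d hd => ?_⟩)
    exact Nat.le_zero.1 (h d hd)
  have : CharP F p := charP_of_card_eq_prime_pow (f := e * m) (by rw [hF, hq, pow_mul])
  let _ : Algebra (ZMod p) F := ZMod.algebra F p
  -- Feasible vectors exist: start from the empty family, all of whose columns are zero columns.
  obtain ⟨r₁, hr₁, -⟩ := exists_feasible hp he hq hm hD hDpos (ι := Empty) (fun _ => 0)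
    (fun _ _ => 0) (fun s => s.elim) rfl (fun _ => rfl)
  obtain ⟨r₀, hr₀, hmin⟩ : ∃ r₀, Feasible q m k D r₀ ∧
      ∀ r, Feasible q m k D r → ∑ x, digitSum p (r₀ x) ≤ ∑ x, digitSum p (r x) := by
    have hne : {N | ∃ r, Feasible q m k D r ∧ ∑ x, digitSum p (r x) = N}.Nonempty :=
      ⟨_, r₁, hr₁, rfl⟩
    obtain ⟨r₀, hr₀, heq⟩ := Nat.sInf_mem hne
    exact ⟨r₀, hr₀, fun r hr => heq.trans_le (Nat.sInf_le ⟨r, hr, rfl⟩)⟩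
  have hobj : ∀ r : exponentSet (q ^ m) k D → ℕ, objective p (q ^ m) k D r =
      1 / ((p : ℚ) - 1) * ((∑ x, digitSum p (r x) : ℕ) : ℚ) := by
    intro r
    rw [objective, Nat.cast_sum]
  obtain ⟨L, _, Γ₀, _, v, j, ζ, hv, hζ⟩ := exists_isWittValuation p F
  refine ⟨objective p (q ^ m) k D r₀, ⟨⟨r₀, hr₀, rfl⟩, ?_⟩, fun f hf => ?_, ?_⟩
  · rintro _ ⟨r, hr, rfl⟩
    rw [hobj, hobj]
    have hp1 : (0 : ℚ) ≤ 1 / ((p : ℚ) - 1) := by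
      have : (1 : ℚ) < p := by exact_mod_cast hp.one_lt
      exact div_nonneg zero_le_one (by linarith)
    exact mul_le_mul_of_nonneg_left (by exact_mod_cast hmin r hr) hp1
  · rw [hobj]
    exact hv.le_valP hζ (hv.valuation_numSolutions_le hζ he hq hm hF hD hDpos hmin f hf)
  · obtain ⟨c, hc⟩ := hv.exists_valuation_numSolutions_eq hζ he hq hm hF hD hDpos hr₀ hmin
    refine ⟨_, degreeSet_polyOfCoeffs c, ?_⟩
    rw [hobj]
    exact hv.valP_eq hζ hc
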